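/- **Surface GCL.** Let $\Sigma^n\subset\mathbb R^3$ be a compact piecewise $C^1$ surface: a finite union of compact embedded $C^1$ hypersurfaces (faces), possibly with boundary and corners, any two of which overlap in a set of zero area (a compact $C^1$ hypersurface with or without boundary is the case of one face). Let $\sigma_\Sigma$ denote the surface measure, let $P_\Sigma(x)=\mathrm{Id}-\mathbf n_\Sigma\otimes\mathbf n_\Sigma$ be the orthogonal projector onto the tangent space of $\Sigma$ at $x$, and let $\nabla_\Sigma \mathbf X=P_\Sigma\nabla \mathbf X$ be the surface gradient of a vector field $\mathbf X$ (it depends only on the values of $\mathbf X$ on $\Sigma$, and is defined almost everywhere on a piecewise $C^1$ surface). Let the mesh velocity have the form $\mathbf w^n=(0,0,w^n)$ with $w^n:\Sigma^n\to\mathbb R$ of class $C^1$ on each face (i.e. on each face it is the restriction of a $C^1$ function on $\mathbb R^3$), let $\delta t>0$, and set $$\mathcal A_{n,n+1}(y)=y+\delta t\,\mathbf w^n(y),\qquad \Sigma^{n+1}=\mathcal A_{n,n+1}(\Sigma^n).$$ Assume that $\mathcal A_{n,n+1}$ is injective on $\Sigma^n$ and that its inverse $\mathcal A_{n,n+1}^{-1}:\Sigma^{n+1}\to\Sigma^n$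 is $C^1$, in the same sense, on the image of each face. 1. Let $\phi:\Sigma^{n+1}\to\mathbb R$ be integrable. Then all the integrals below converge. Suppose in addition that $\phi\ge 0$. If $$1+\delta t\,\mathrm{tr}(\nabla_{\Sigma^n}\mathbf w^n)\ge 0\quad\text{almost everywhere on }\Sigma^n,$$ then $$\int_{\Sigma^{n+1}}\phi\,d\sigma_{\Sigma^{n+1}}-\int_{\Sigma^n}\phi\circ\mathcal A_{n,n+1}\,d\sigma_{\Sigma^n}\ \ge\ \delta t\int_{\Sigma^n}\phi\circ\mathcal A_{n,n+1}\,\mathrm{tr}(\nabla_{\Sigma^n}\mathbf w^n)\,d\sigma_{\Sigma^n}.\qquad(\mathrm a)$$ If $$1-\delta t\,\mathrm{tr}\big(\nabla_{\Sigma^{n+1}}(\mathbf w^n\circ\mathcal A_{n,n+1}^{-1})\big)\ge 0\quad\text{almost everywhere on }\Sigma^{n+1},$$ then $$\int_{\Sigma^{n+1}}\phi\,d\sigma_{\Sigma^{n+1}}-\int_{\Sigma^n}\phi\circ\mathcal A_{n,n+1}\,d\sigma_{\Sigma^n}\ \le\ \delta t\int_{\Sigma^{n+1}}\phi\,\mathrm{tr}\big(\nabla_{\Sigma^{n+1}}(\mathbf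 w^n\circ\mathcal A_{n,n+1}^{-1})\big)\,d\sigma_{\Sigma^{n+1}}.\qquad(\mathrm b)$$ 2. In both (a) and (b) the difference between the two sides is $O(\delta t^2)$ as $\delta t\to0$: for every $L$ there are $C$ and $\delta_0>0$, depending only on $\Sigma^n$ and $L$, such that for all $w^n$ and $\delta t\in(0,\delta_0]$ as above with $\|\nabla_{\Sigma^n}\mathbf w^n\|\le L$ almost everywhere on $\Sigma^n$, and for every integrable $\phi$ (of any sign) with $|\phi|\le M$ on $\Sigma^{n+1}$, where $M\ge 0$, the absolute value of the difference between the two sides of (a), and that of (b), is at most $C\,M\,\delta t^2$. -/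

import Mathlib

open Set MeasureTheory

noncomputable section

namespace SurfaceGCL

/-- The physical space `ℝ³` with its Euclidean structure. -/
abbrev Space : Type := EuclideanSpace ℝ (Fin 3)

/-- The third vector of the orthonormal basis, the direction of the mesh displacement. -/
def e3 : Space := EuclideanSpace.single 2 1

/-! ### Surfaces -/

/-- Local model of a surface: the plane `z₃ = 0` (`J = ∅`), a half plane of it (`J = {0}` or
`J = {1}`), or a quadrant of it (`J = {0, 1}`). -/
def model (J : Set (Fin 3)) : Set Space := {z | z 2 = 0 ∧ ∀ j ∈ J, 0 ≤ z j}

/-- `S` is a compact embedded `C¹` hypersurface of `ℝ³`, possibly with boundary and corners: near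
each of its points a `C¹` diffeomorphism between open subsets of `ℝ³` straightens `S` to a plane,
to a half plane, or to a quadrant. -/
def IsC1Surface (S : Set Space) : Prop :=
  IsCompact S ∧ ∀ x ∈ S, ∃ (e : OpenPartialHomeomorph Space Space) (J : Set (Fin 3)),
    x ∈ e.source ∧ ContDiffOn ℝ 1 e e.source ∧ ContDiffOn ℝ 1 e.symm e.target ∧
      e.IsImage S (model J)

/-- The surface measure `σ_S`: the two-dimensional Hausdorff measure, normalized so that it is
Lebesgue measure (area) on planes, restricted to `S`. -/
def surfaceMeasure (S : Set Space) : Measure Space := (μHE[2]).restrict S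

/-- The union of the family `F` is a piecewise `C¹` surface with faces `F i`: each face is a
compact `C¹` hypersurface (possibly with boundary and corners), and two distinct faces overlap in
a set of zero area only. A compact `C¹` hypersurface, with or without boundary, is the case of a
single face. -/
def IsPiecewiseC1Surface {ι : Type*} (F : ι → Set Space) : Prop :=
  (∀ i, IsC1Surface (F i)) ∧ Pairwise fun i j => surfaceMeasure (F i) (F j) = 0

/-- The scalar function `u`, whose values on `⋃ i, F i` alone matter, is `C¹` on each face: it
agrees on the face with a `C¹` function of the ambient space. -/
def IsPiecewiseC1On {ι : Type*} (F : ι → Set Space) (u : Space → ℝ) : Prop :=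
  ∀ i, ∃ U : Space → ℝ, ContDiff ℝ 1 U ∧ EqOn u U (F i)

/-! ### Tangential differential operators -/

/-- The tangent space to `S` at `x`: the span of the limits of the directions of the secants of
`S` at `x`. It is a plane at each point near which `S` is a `C¹` hypersurface with or without
boundary. -/
def tangentSpace (S : Set Space) (x : Space) : Submodule ℝ Space :=
  Submodule.span ℝ (tangentConeAt ℝ S x)

/-- The orthogonal projector onto the tangent space, `Id - n ⊗ n` with `n` a unit normal. -/
def tangentProj (S : Set Space) (x : Space) : Space →L[ℝ] Space :=
  (tangentSpace S x).starProjection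

/-- The surface gradient `∇_S X = P_S ∇X` of a vector field, where `(∇X)ᵢⱼ = ∂ᵢ Xⱼ`, so that `∇X`
is the transpose of the derivative `DX`. As the derivative is taken along `S`, only the values of
`X` on `S` enter. It does not depend on the choice of a derivative along `S`, since
`P_S (DX)ᵀ = (DX P_S)ᵀ`; if `X` is differentiable at `x` then the full derivative gives the same
result. -/
def surfaceGradient (S : Set Space) (X : Space → Space) (x : Space) : Space →L[ℝ] Space :=
  tangentProj S x ∘L ContinuousLinearMap.adjoint (fderivWithin ℝ X S x)

/-- The trace `tr (∇_S X)` of the surface gradient, that is, the tangential divergence of `X`. -/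
def surfaceDiv (S : Set Space) (X : Space → Space) (x : Space) : ℝ :=
  LinearMap.trace ℝ Space (surfaceGradient S X x : Space →ₗ[ℝ] Space)

/-! ### The displacement of the surface over one time step -/

/-- The domain velocity `(0, 0, w)`. -/
def meshVelocity (w : Space → ℝ) (y : Space) : Space := w y • e3

/-- The displacement map `y ↦ y + δt 𝐰(y)` with `𝐰 = (0, 0, w)`. -/
def ale (w : Space → ℝ) (δt : ℝ) (y : Space) : Space := y + δt • meshVelocity w y

/-- The inverse, defined on `ale w δt '' S`, of the displacement map of `S`. -/
def aleInv (S : Set Space) (w : Space → ℝ) (δt : ℝ) : Space → Space :=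
  Function.invFunOn (ale w δt) S

/-- The displacement of the surface with faces `F` is regular: `w` is `C¹` on each face, the
displacement map is a bijection onto the displaced surface, and its inverse
`x ↦ x - δt 𝐰(A⁻¹(x))` is `C¹` on each displaced face, that is, `w ∘ A⁻¹` is. -/
def IsRegularDisplacement {ι : Type*} (F : ι → Set Space) (w : Space → ℝ) (δt : ℝ) : Prop :=
  IsPiecewiseC1On F w ∧ InjOn (ale w δt) (⋃ i, F i) ∧
    IsPiecewiseC1On (fun i => ale w δt '' F i) (w ∘ aleInv (⋃ i, F i) w δt)

/-- The tangential divergence `tr (∇_{Σⁿ} 𝐰)` on the surface `S = Σⁿ`. -/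
def divOld (S : Set Space) (w : Space → ℝ) : Space → ℝ := surfaceDiv S (meshVelocity w)

/-- The tangential divergence `tr (∇_{Σⁿ⁺¹} (𝐰 ∘ A⁻¹))` on the displaced surface
`Σⁿ⁺¹ = A(S)`, with `S = Σⁿ`. -/
def divNew (S : Set Space) (w : Space → ℝ) (δt : ℝ) : Space → ℝ :=
  surfaceDiv (ale w δt '' S) (meshVelocity w ∘ aleInv S w δt)

/-- `∫_{Σⁿ⁺¹} φ - ∫_{Σⁿ} φ ∘ A`. -/
def increment (S : Set Space) (w : Space → ℝ) (δt : ℝ) (φ : Space → ℝ) : ℝ :=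
  (∫ x, φ x ∂surfaceMeasure (ale w δt '' S)) - ∫ y, φ (ale w δt y) ∂surfaceMeasure S

end SurfaceGCL

end

/-!
The surface enters only through its tangent planes. A set has a *strictly tangent plane* at a point
if its secants near the point make small angles with the plane; together with the continuity of the
tangent spaces this is `HasTangentPlaneAt`. A plane, a half plane and a quadrant have this property,
and it is invariant under `C¹` diffeomorphisms (`IsC1DiffeoOn.hasTangentPlaneAt_image`; the
continuity of the tangent spaces comes from the Kerzman–Stein formula, which recovers an orthogonal
projection from an oblique one). So `C¹` surfaces have it at every point, up to the boundary.

Near such a point, the orthogonal projection onto the tangent plane is almost an isometry on the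
set, and a `C¹` map is almost its derivative composed with this projection. As the Hausdorff measure
is monotone under Lipschitz maps, the map changes areas almost by the factor of its derivative on
the plane (`eventually_area_image_le`), and a countable cover turns this into the area formula
`IsC1DiffeoOn.map_withDensity`.

For the displacement `y ↦ y + δ (0, 0, u(y))`, write `g` for the tangential gradient of `u`, `d` for
the tangential divergence `g · e3` and `P` for the projector. The Gram determinant of the derivative
gives the Jacobian `J ^ 2 = (1 + δ d) ^ 2 + δ ^ 2 (1 - |P e3| ^ 2) |g| ^ 2`. Hence `J ≥ 1 + δ d`,
which is the first inequality, and `J ≤ 1 + δ d + δ ^ 2 |g| ^ 2` for small `δ |g|`, which bounds its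
gap. The second inequality and its gap are the first ones for the inverse displacement, whose time
step is `-δ`; the gradient of the transported function is at most `2 |g|` for small `δ |g|`.

For a piecewise `C¹` surface all this is applied to the set of points that lie in exactly one face.
It has full area, the displacement maps it to the corresponding set of the displaced surface, and
near each of its points it coincides both with a face and with the whole surface.
-/

noncomputable section

namespace SurfaceGCL

open Filter Topology Asymptotics Module

/-! ### Orthogonal and oblique projections -/

lemma norm_sub_starProjection_le (T : Submodule ℝ Space) (w : Space) {t : Space} (ht : t ∈ T) :
    ‖w - T.starProjection w‖ ≤ ‖w - t‖ := by
  have h : w - T.starProjection w = Tᗮ.starProjection (w - t) := by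
    rw [Submodule.starProjection_orthogonal_val, map_sub,
      Submodule.starProjection_eq_self_iff.mpr ht]
    abel
  rw [h]
  exact Submodule.norm_starProjection_apply_le _ _

/-- The operator is the identity plus a skew-adjoint one, hence injective. -/
lemma isUnit_one_add_sub_adjoint (R : Space →L[ℝ] Space) :
    IsUnit (1 + R - ContinuousLinearMap.adjoint R) := by
  rw [ContinuousLinearMap.isUnit_iff_bijective]
  set f : Space →L[ℝ] Space := 1 + R - ContinuousLinearMap.adjoint R
  have hinj : Function.Injective f := by
    rw [injective_iff_map_eq_zero]
    intro v hv
    have h : inner ℝ (f v) v = inner ℝ v v := by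
      simp only [f, sub_apply, add_apply,
        one_apply_eq_self, inner_sub_left, inner_add_left,
        ContinuousLinearMap.adjoint_inner_left, real_inner_comm v (R v)]
      ring
    rw [hv, inner_zero_left] at h
    exact inner_self_eq_zero.mp h.symm
  exact ⟨hinj, LinearMap.surjective_of_injective (f := (f : Space →ₗ[ℝ] Space)) hinj⟩

/-- The Kerzman–Stein formula: an oblique projection `R` onto `T` determines the orthogonal
projection, and it does so continuously. -/
lemma starProjection_eq_mul_inverse (T : Submodule ℝ Space) (R : Space →L[ℝ] Space)
    (hR : ∀ v, R v ∈ T) (hR' : ∀ v ∈ T, R v = v) :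
    T.starProjection = R * Ring.inverse (1 + R - ContinuousLinearMap.adjoint R) := by
  have h1 : T.starProjection * R = R := by
    ext1 v
    exact Submodule.starProjection_eq_self_iff.mpr (hR v)
  have h2 : R * T.starProjection = T.starProjection := by
    ext1 v
    exact hR' _ (Submodule.starProjection_apply_mem _ _)
  have h3 : T.starProjection * star R = T.starProjection := by
    have h := congrArg star h2
    rwa [star_mul, (isSelfAdjoint_starProjection T).star_eq] at h
  have h4 : T.starProjection * (1 + R - ContinuousLinearMap.adjoint R) = R := by
    rw [← ContinuousLinearMap.star_eq_adjoint, mul_sub, mul_add, h1, h3, mul_one]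
    abel
  have h5 := congrArg (· * Ring.inverse (1 + R - ContinuousLinearMap.adjoint R)) h4
  simpa only [mul_assoc, Ring.mul_inverse_cancel _ (isUnit_one_add_sub_adjoint R), mul_one] using h5

/-! ### Tangent spaces and derivatives along a set -/

lemma tangentSpace_congr {S S' : Set Space} {x : Space} (h : 𝓝[S] x = 𝓝[S'] x) :
    tangentSpace S x = tangentSpace S' x := by
  rw [tangentSpace, tangentSpace, tangentConeAt_congr h]

lemma nhdsWithin_inter_eq {S : Set Space} {x : Space} {U : Set Space} (hU : U ∈ 𝓝 x) :
    𝓝[S ∩ U] x = 𝓝[S] x := nhdsWithin_inter_of_mem' (mem_nhdsWithin_of_mem_nhds hU)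

/-- Derivatives along `S` are not unique, but they agree on the tangent space. -/
lemma eqOn_tangentSpace {V : Type*} [NormedAddCommGroup V] [NormedSpace ℝ V] {f : Space → V}
    {S : Set Space} {x : Space} {L L' : Space →L[ℝ] V}
    (h : HasFDerivWithinAt f L S x) (h' : HasFDerivWithinAt f L' S x) :
    ∀ v ∈ tangentSpace S x, L v = L' v := by
  have hle : tangentSpace S x ≤ LinearMap.eqLocus (L : Space →ₗ[ℝ] V) (L' : Space →ₗ[ℝ] V) :=
    Submodule.span_le.mpr fun v hv => h.unique_on h' hv
  exact fun v hv => hle hv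

lemma map_mem_tangentSpace_image {A : Space → Space} {S : Set Space} {x : Space}
    {L : Space →L[ℝ] Space} (h : HasFDerivWithinAt A L S x) :
    ∀ v ∈ tangentSpace S x, L v ∈ tangentSpace (A '' S) (A x) := by
  have hle : tangentSpace S x ≤
      (tangentSpace (A '' S) (A x)).comap (L : Space →ₗ[ℝ] Space) :=
    Submodule.span_le.mpr fun v hv => Submodule.subset_span (h.mapsTo_tangent_cone hv)
  exact fun v hv => hle hv

lemma fderiv_leftInverse_of_leftInvOn {A B : Space → Space} {S : Set Space} {x : Space}
    {L K : Space →L[ℝ] Space} (hx : x ∈ S) (hBA : LeftInvOn B A S)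
    (hA : HasFDerivWithinAt A L S x) (hB : HasFDerivWithinAt B K (A '' S) (A x)) :
    ∀ v ∈ tangentSpace S x, K (L v) = v := by
  have h1 : HasFDerivWithinAt (B ∘ A) (K.comp L) S x := hB.comp x hA (mapsTo_image A S)
  have h2 : HasFDerivWithinAt (B ∘ A) (ContinuousLinearMap.id ℝ Space) S x :=
    (hasFDerivWithinAt_id x S).congr (fun y hy => hBA hy) (hBA hx)
  exact eqOn_tangentSpace h1 h2

/-- `f` is `C¹` near `x` along `S`: near `x` it agrees on `S` with a map that is `C¹` in a
neighbourhood of `x` in space. Such a map has a strict derivative along `S`, which would not follow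
from `ContDiffWithinAt` on a general set `S`. -/
def IsC1WithinAt {V : Type*} [NormedAddCommGroup V] [NormedSpace ℝ V] (f : Space → V)
    (S : Set Space) (x : Space) : Prop :=
  ∃ g : Space → V, ContDiffAt ℝ 1 g x ∧ f =ᶠ[𝓝[S] x] g

lemma hasFDerivWithinAt_of_eventuallyEq {V : Type*} [NormedAddCommGroup V] [NormedSpace ℝ V]
    {f g : Space → V} {S : Set Space} {x : Space} (hx : x ∈ S) (hg : ContDiffAt ℝ 1 g x)
    (h : f =ᶠ[𝓝[S] x] g) : HasFDerivWithinAt f (fderiv ℝ g x) S x :=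
  (hg.differentiableAt one_ne_zero).hasFDerivAt.hasFDerivWithinAt.congr_of_eventuallyEq h
    (h.self_of_nhdsWithin hx)

lemma IsC1WithinAt.continuousWithinAt {V : Type*} [NormedAddCommGroup V] [NormedSpace ℝ V]
    {f : Space → V} {S : Set Space} {x : Space} (hx : x ∈ S) (h : IsC1WithinAt f S x) :
    ContinuousWithinAt f S x := by
  obtain ⟨g, hg, hfg⟩ := h
  exact (hasFDerivWithinAt_of_eventuallyEq hx hg hfg).continuousWithinAt

/-- `A` maps `S` bijectively onto its image, with inverse `B`, and both maps are `C¹`. -/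
structure IsC1DiffeoOn (S : Set Space) (A B : Space → Space) : Prop where
  leftInvOn : LeftInvOn B A S
  c1 : ∀ x ∈ S, IsC1WithinAt A S x
  c1_inv : ∀ y ∈ A '' S, IsC1WithinAt B (A '' S) y

lemma IsC1DiffeoOn.image_image {S : Set Space} {A B : Space → Space} (h : IsC1DiffeoOn S A B) :
    B '' (A '' S) = S := h.leftInvOn.image_image

lemma IsC1DiffeoOn.symm {S : Set Space} {A B : Space → Space} (h : IsC1DiffeoOn S A B) :
    IsC1DiffeoOn (A '' S) B A where
  leftInvOn := by
    rintro _ ⟨x, hx, rfl⟩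
    rw [h.leftInvOn hx]
  c1 := h.c1_inv
  c1_inv := by
    rw [h.image_image]
    exact h.c1

lemma IsC1DiffeoOn.continuousOn {S : Set Space} {A B : Space → Space} (h : IsC1DiffeoOn S A B) :
    ContinuousOn A S := fun x hx => (h.c1 x hx).continuousWithinAt hx

lemma IsC1DiffeoOn.injOn {S : Set Space} {A B : Space → Space} (h : IsC1DiffeoOn S A B) :
    InjOn A S := h.leftInvOn.injOn

/-! ### Strictly tangent planes -/

/-- The subspace `T` is strictly tangent to `S` at `x`: the secants of `S` through two points
which both tend to `x` make an angle with `T` that tends to zero. -/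
def StrictlyTangentAt (S : Set Space) (T : Submodule ℝ Space) (x : Space) : Prop :=
  (fun p : Space × Space => (p.1 - p.2) - T.starProjection (p.1 - p.2))
    =o[𝓝[S ×ˢ S] (x, x)] fun p => p.1 - p.2

/-- The set `S` has at `x` a strictly tangent plane, and its tangent spaces depend continuously
on the point there. This is all that is used of a `C¹` surface. -/
structure HasTangentPlaneAt (S : Set Space) (x : Space) : Prop where
  finrank_eq : finrank ℝ (tangentSpace S x) = 2
  strict : StrictlyTangentAt S (tangentSpace S x) x
  cont : ContinuousWithinAt (tangentProj S) S x

lemma HasTangentPlaneAt.congr {S S' : Set Space} {x : Space} (h : S =ᶠ[𝓝 x] S')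
    (hS : HasTangentPlaneAt S x) : HasTangentPlaneAt S' x := by
  have hn : 𝓝[S] x = 𝓝[S'] x := nhdsWithin_eq_iff_eventuallyEq.mpr h
  have hT : tangentProj S =ᶠ[𝓝 x] tangentProj S' := by
    filter_upwards [eventually_eventuallyEq_nhds.mpr h] with y hy
    simp only [tangentProj, tangentSpace_congr (nhdsWithin_eq_iff_eventuallyEq.mpr hy)]
  refine ⟨by rw [← tangentSpace_congr hn, hS.finrank_eq], ?_, ?_⟩
  · have := hS.strict
    simp only [tangentSpace_congr hn] at this
    rwa [StrictlyTangentAt, nhdsWithin_prod_eq, hn,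
      ← nhdsWithin_prod_eq] at this
  · have := hS.cont.congr_of_eventuallyEq (hT.symm.filter_mono nhdsWithin_le_nhds)
      hT.symm.eq_of_nhds
    rwa [ContinuousWithinAt, hn] at this

lemma IsC1DiffeoOn.tendsto_inv {S : Set Space} {A B : Space → Space} (h : IsC1DiffeoOn S A B)
    {x : Space} (hx : x ∈ S) : Tendsto B (𝓝[A '' S] (A x)) (𝓝[S] x) := by
  have := (h.symm.continuousOn (A x) (mem_image_of_mem A hx)).tendsto_nhdsWithin
    (t := S) (by rw [← h.image_image]; exact fun y hy => ⟨y, by rwa [h.image_image] at hy, rfl⟩)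
  rwa [h.leftInvOn hx] at this

lemma tendsto_prod_image {S : Set Space} {A B : Space → Space} (h : IsC1DiffeoOn S A B)
    {x : Space} (hx : x ∈ S) :
    Tendsto (Prod.map B B) (𝓝[(A '' S) ×ˢ (A '' S)] (A x, A x)) (𝓝[S ×ˢ S] (x, x)) := by
  rw [nhdsWithin_prod_eq, nhdsWithin_prod_eq]
  exact (h.tendsto_inv hx).prodMap (h.tendsto_inv hx)

/-- The strict derivative along `S` of a map that is `C¹` along `S`. -/
lemma isLittleO_sub_of_eventuallyEq {V : Type*} [NormedAddCommGroup V] [NormedSpace ℝ V]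
    {f g : Space → V} {S : Set Space} {x : Space} (hg : ContDiffAt ℝ 1 g x)
    (h : f =ᶠ[𝓝[S] x] g) :
    (fun p : Space × Space => f p.1 - f p.2 - fderiv ℝ g x (p.1 - p.2))
      =o[𝓝[S ×ˢ S] (x, x)] fun p => p.1 - p.2 := by
  have h1 := ((hg.hasStrictFDerivAt one_ne_zero).isLittleO).mono
    (nhdsWithin_le_nhds (s := S ×ˢ S) (a := (x, x)))
  refine h1.congr' ?_ EventuallyEq.rfl
  rw [nhdsWithin_prod_eq]
  filter_upwards [tendsto_fst.eventually h, tendsto_snd.eventually h] with p hp1 hp2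
  rw [hp1, hp2]

/-- The strict derivative of `A` only sees the tangential part of a secant of `S`. -/
lemma isLittleO_sub_fderiv_starProjection {A g : Space → Space} {S : Set Space} {x : Space}
    {T : Submodule ℝ Space} (hT : StrictlyTangentAt S T x) (hg : ContDiffAt ℝ 1 g x)
    (h : A =ᶠ[𝓝[S] x] g) :
    (fun p : Space × Space => A p.1 - A p.2 - fderiv ℝ g x (T.starProjection (p.1 - p.2)))
      =o[𝓝[S ×ˢ S] (x, x)] fun p => p.1 - p.2 := by
  have h1 := isLittleO_sub_of_eventuallyEq hg h
  have h2 := ((fderiv ℝ g x).isBigO_comp (fun p : Space × Space =>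
    (p.1 - p.2) - T.starProjection (p.1 - p.2)) (𝓝[S ×ˢ S] (x, x))).trans_isLittleO hT
  refine (h1.add h2).congr_left fun p => ?_
  rw [(fderiv ℝ g x).map_sub (p.1 - p.2) (T.starProjection (p.1 - p.2))]
  abel

/-- The derivatives of a `C¹` diffeomorphism and of its inverse are inverse to each other on the
tangent spaces. -/
lemma tangentSpace_image {S : Set Space} {A B : Space → Space} {x : Space}
    {L K : Space →L[ℝ] Space} (hx : x ∈ S) (h : IsC1DiffeoOn S A B)
    (hA : HasFDerivWithinAt A L S x) (hB : HasFDerivWithinAt B K (A '' S) (A x)) :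
    (∀ v ∈ tangentSpace S x, L v ∈ tangentSpace (A '' S) (A x)) ∧
      (∀ v ∈ tangentSpace (A '' S) (A x), K v ∈ tangentSpace S x) ∧
      (∀ v ∈ tangentSpace S x, K (L v) = v) ∧
      (∀ v ∈ tangentSpace (A '' S) (A x), L (K v) = v) := by
  have hA' : HasFDerivWithinAt A L (B '' (A '' S)) (B (A x)) := by
    rwa [h.image_image, h.leftInvOn hx]
  refine ⟨map_mem_tangentSpace_image hA, ?_, fderiv_leftInverse_of_leftInvOn hx h.leftInvOn hA hB,
    fderiv_leftInverse_of_leftInvOn (mem_image_of_mem A hx) h.symm.leftInvOn hB hA'⟩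
  have := map_mem_tangentSpace_image hB
  rwa [h.image_image, h.leftInvOn hx] at this

/-- The existence of strictly tangent planes is invariant under `C¹` diffeomorphisms. -/
lemma IsC1DiffeoOn.hasTangentPlaneAt_image {S : Set Space} {A B : Space → Space}
    (h : IsC1DiffeoOn S A B) (hS : ∀ x ∈ S, HasTangentPlaneAt S x) :
    ∀ y ∈ A '' S, HasTangentPlaneAt (A '' S) y := by
  rintro _ ⟨x, hx, rfl⟩
  obtain ⟨a, ha, hAa⟩ := h.c1 x hx
  obtain ⟨b, hb, hBb⟩ := h.c1_inv (A x) (mem_image_of_mem A hx)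
  have hxx := h.leftInvOn hx
  have hA := hasFDerivWithinAt_of_eventuallyEq hx ha hAa
  have hB := hasFDerivWithinAt_of_eventuallyEq (mem_image_of_mem A hx) hb hBb
  obtain ⟨hL, hK, hKL, hLK⟩ := tangentSpace_image hx h hA hB
  have hBt := h.tendsto_inv hx
  refine ⟨?_, ?_, ?_⟩
  · -- the derivatives are injective in both directions
    rw [← (hS x hx).finrank_eq]
    refine le_antisymm ?_ ?_
    · exact LinearMap.finrank_le_finrank_of_injective
        (f := (fderiv ℝ b (A x) : Space →ₗ[ℝ] Space).restrict hK)
        (fun v w hvw => Subtype.ext (by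
          rw [← hLK v v.2, ← hLK w w.2]; exact congrArg _ (congrArg Subtype.val hvw)))
    · exact LinearMap.finrank_le_finrank_of_injective
        (f := (fderiv ℝ a x : Space →ₗ[ℝ] Space).restrict hL)
        (fun v w hvw => Subtype.ext (by
          rw [← hKL v v.2, ← hKL w w.2]; exact congrArg _ (congrArg Subtype.val hvw)))
  · -- the derivative of `A` sends the projection of a secant of `S` to a tangent vector that
    -- is close to the corresponding secant of the image
    have h1 := (isLittleO_sub_fderiv_starProjection (hS x hx).strict ha hAa).comp_tendsto
      (tendsto_prod_image h hx)
    have h2 : (fun p : Space × Space => B p.1 - B p.2) =O[𝓝[(A '' S) ×ˢ (A '' S)] (A x, A x)]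
        fun p => p.1 - p.2 := by
      have := (isLittleO_sub_of_eventuallyEq hb hBb).isBigO.add
        ((fderiv ℝ b (A x)).isBigO_comp (fun p : Space × Space => p.1 - p.2) _)
      simpa using this
    refine IsBigO.trans_isLittleO (IsBigO.of_bound 1 ?_) (h1.trans_isBigO h2)
    filter_upwards [self_mem_nhdsWithin] with p hp
    simp only [Function.comp_apply, Prod.map_fst, Prod.map_snd, one_mul]
    rw [h.symm.leftInvOn hp.1, h.symm.leftInvOn hp.2]
    exact norm_sub_starProjection_le _ _ (hL _ (Submodule.starProjection_apply_mem _ _))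
  · -- the oblique projections onto the tangent spaces of the image near `A x`
    set R : Space → Space →L[ℝ] Space := fun y =>
      (fderiv ℝ a (B y)).comp ((tangentProj S (B y)).comp (fderiv ℝ b y))
    have hPR : tangentProj (A '' S) =ᶠ[𝓝[A '' S] (A x)] fun y =>
        R y * Ring.inverse (1 + R y - ContinuousLinearMap.adjoint (R y)) := by
      have ea : ∀ᶠ z in 𝓝[S] x, ContDiffAt ℝ 1 a z ∧ A =ᶠ[𝓝[S] z] a :=
        ((ha.eventually (by simp)).filter_mono nhdsWithin_le_nhds).and
          (eventually_eventually_nhdsWithin.mpr hAa)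
      have eb : ∀ᶠ y in 𝓝[A '' S] (A x), ContDiffAt ℝ 1 b y ∧ B =ᶠ[𝓝[A '' S] y] b :=
        ((hb.eventually (by simp)).filter_mono nhdsWithin_le_nhds).and
          (eventually_eventually_nhdsWithin.mpr hBb)
      filter_upwards [hBt.eventually ea, eb, self_mem_nhdsWithin] with y hya hyb hy
      obtain ⟨z, hz, rfl⟩ := hy
      simp only [R]
      rw [h.leftInvOn hz] at hya ⊢
      obtain ⟨hL', hK', -, hLK'⟩ := tangentSpace_image hz h
        (hasFDerivWithinAt_of_eventuallyEq hz hya.1 hya.2)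
        (hasFDerivWithinAt_of_eventuallyEq (mem_image_of_mem A hz) hyb.1 hyb.2)
      refine starProjection_eq_mul_inverse _ _ (fun v => ?_) (fun v hv => ?_)
      · exact hL' _ (Submodule.starProjection_apply_mem _ _)
      · simp only [tangentProj, ContinuousLinearMap.comp_apply]
        rw [Submodule.starProjection_eq_self_iff.mpr (hK' v hv), hLK' v hv]
    have hRc : ContinuousWithinAt R (A '' S) (A x) := by
      have c1 : ContinuousWithinAt (fun y => fderiv ℝ a (B y)) (A '' S) (A x) := by
        have := (ha.continuousAt_fderiv one_ne_zero).tendsto.comp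
          (hBt.mono_right nhdsWithin_le_nhds)
        rwa [ContinuousWithinAt, hxx]
      have c2 : ContinuousWithinAt (fun y => tangentProj S (B y)) (A '' S) (A x) := by
        have := (hS x hx).cont.tendsto.comp hBt
        rwa [ContinuousWithinAt, hxx]
      have c3 : ContinuousWithinAt (fderiv ℝ b) (A '' S) (A x) :=
        (hb.continuousAt_fderiv one_ne_zero).continuousWithinAt
      exact c1.clm_comp (c2.clm_comp c3)
    have hinv : ContinuousWithinAt (fun y =>
        Ring.inverse (1 + R y - ContinuousLinearMap.adjoint (R y))) (A '' S) (A x) := by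
      obtain ⟨u, hu⟩ := isUnit_one_add_sub_adjoint (R (A x))
      have hc := NormedRing.inverse_continuousAt u
      rw [hu] at hc
      refine ContinuousAt.comp_continuousWithinAt (g := Ring.inverse) hc ?_
      refine (continuousWithinAt_const.add hRc).sub ?_
      exact ContinuousLinearMap.adjoint.continuous.continuousAt.comp_continuousWithinAt hRc
    exact (hRc.mul hinv).congr_of_eventuallyEq hPR
      (hPR.self_of_nhdsWithin (mem_image_of_mem A hx))

/-! ### Tangent planes of `C¹` surfaces -/

/-- The plane `z₃ = 0`. -/
def modelPlane : Submodule ℝ Space := LinearMap.ker (EuclideanSpace.projₗ (𝕜 := ℝ) (2 : Fin 3))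

lemma mem_modelPlane {v : Space} : v ∈ modelPlane ↔ v 2 = 0 := Iff.rfl

lemma tangentSpace_model {J : Set (Fin 3)} {z : Space} (hz : z ∈ model J) :
    tangentSpace (model J) z = modelPlane := by
  apply le_antisymm
  · intro v hv
    have h1 : HasFDerivWithinAt (fun y : Space => y 2)
        (EuclideanSpace.proj (𝕜 := ℝ) (2 : Fin 3)) (model J) z :=
      (EuclideanSpace.proj (𝕜 := ℝ) (2 : Fin 3)).hasFDerivWithinAt
    have h2 : HasFDerivWithinAt (fun y : Space => y 2) (0 : Space →L[ℝ] ℝ) (model J) z :=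
      (hasFDerivWithinAt_const (0 : ℝ) z (model J)).congr (fun y hy => hy.1) hz.1
    exact eqOn_tangentSpace h1 h2 v hv
  · -- at boundary points only half of the directions are tangent, but they still span the plane
    have key : ∀ j : Fin 3, j ≠ 2 →
        (EuclideanSpace.single j (1 : ℝ) : Space) ∈ tangentSpace (model J) z := by
      intro j hj
      apply Submodule.subset_span
      have hseg : segment ℝ z (z + EuclideanSpace.single j (1 : ℝ)) ⊆ model J := by
        rw [segment_eq_image']
        rintro _ ⟨t, ht, rfl⟩
        refine ⟨?_, fun i hi => ?_⟩
        · simp [hz.1, hj.symm]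
        · have h0 := hz.2 i hi
          by_cases hij : i = j
          · subst hij
            simpa using add_nonneg h0 ht.1
          · simpa [hij] using h0
      simpa using mem_tangentConeAt_of_segment_subset hseg
    intro v hv
    have : v = v 0 • EuclideanSpace.single 0 (1 : ℝ) + v 1 • EuclideanSpace.single 1 (1 : ℝ) := by
      ext i
      fin_cases i
      · simp
      · simp
      · simpa using mem_modelPlane.mp hv
    rw [this]
    exact Submodule.add_mem _ (Submodule.smul_mem _ _ (key 0 (by decide)))
      (Submodule.smul_mem _ _ (key 1 (by decide)))

lemma finrank_modelPlane : finrank ℝ modelPlane = 2 := by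
  have h : (EuclideanSpace.projₗ (𝕜 := ℝ) (2 : Fin 3) : Module.Dual ℝ Space) ≠ 0 := by
    intro h
    simpa using LinearMap.congr_fun h (EuclideanSpace.single 2 1)
  have := Module.Dual.finrank_ker_add_one_of_ne_zero h
  rw [finrank_euclideanSpace_fin] at this
  exact Nat.succ_injective this

lemma hasTangentPlaneAt_model {J : Set (Fin 3)} {z : Space} (hz : z ∈ model J) :
    HasTangentPlaneAt (model J) z := by
  refine ⟨by rw [tangentSpace_model hz, finrank_modelPlane], ?_, ?_⟩
  · refine IsLittleO.congr' (isLittleO_zero _ _) ?_ EventuallyEq.rfl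
    filter_upwards [self_mem_nhdsWithin] with p hp
    rw [Submodule.starProjection_eq_self_iff.mpr, sub_self]
    rw [tangentSpace_model hz, mem_modelPlane]
    simp [hp.1.1, hp.2.1]
  · refine (continuousWithinAt_const (b := modelPlane.starProjection)).congr (fun y hy => ?_) ?_
    · simp only [tangentProj, tangentSpace_model hy]
    · simp only [tangentProj, tangentSpace_model hz]

/-- Near each of its points a `C¹` surface is the image of a piece of a model under a chart. -/
lemma IsC1Surface.hasTangentPlaneAt {S : Set Space} (hS : IsC1Surface S) :
    ∀ x ∈ S, HasTangentPlaneAt S x := by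
  intro x hx
  obtain ⟨e, J, hxe, he, he', hJ⟩ := hS.2 x hx
  have himg : e.symm '' (model J ∩ e.target) = S ∩ e.source := by
    ext y
    constructor
    · rintro ⟨z, ⟨hz, hzt⟩, rfl⟩
      exact ⟨(hJ.symm_apply_mem_iff hzt).mpr hz, e.map_target hzt⟩
    · rintro ⟨hy, hye⟩
      exact ⟨e y, ⟨(hJ.apply_mem_iff hye).mpr hy, e.map_source hye⟩, e.left_inv hye⟩
  have hD : IsC1DiffeoOn (model J ∩ e.target) e.symm e := by
    refine ⟨fun z hz => e.right_inv hz.2, fun z hz => ?_, fun y hy => ?_⟩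
    · exact ⟨e.symm, he'.contDiffAt (e.open_target.mem_nhds hz.2), EventuallyEq.rfl⟩
    · rw [himg] at hy
      exact ⟨e, he.contDiffAt (e.open_source.mem_nhds hy.2), EventuallyEq.rfl⟩
  have hloc : ∀ (S U : Set Space), IsOpen U → ∀ y ∈ U, (S ∩ U : Set Space) =ᶠ[𝓝 y] S := by
    intro S U hU y hy
    rw [← nhdsWithin_eq_iff_eventuallyEq]
    exact nhdsWithin_inter_eq (hU.mem_nhds hy)
  have hmodel : ∀ z ∈ model J ∩ e.target, HasTangentPlaneAt (model J ∩ e.target) z :=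
    fun z hz => (hasTangentPlaneAt_model hz.1).congr (hloc _ _ e.open_target z hz.2).symm
  have := hD.hasTangentPlaneAt_image hmodel x (by rw [himg]; exact ⟨hx, hxe⟩)
  rw [himg] at this
  exact this.congr (hloc _ _ e.open_source x hxe)

/-! ### Local comparison of areas -/

/-- If `q` is `K`-Lipschitz with respect to `p` on `C`, then it increases areas by a factor of at
most `K ^ 2` with respect to `p`. -/
lemma area_image_le_of_norm_sub_le {p q : Space → Space} {C : Set Space} {K : ℝ} (hK : 0 ≤ K)
    (h : ∀ y ∈ C, ∀ z ∈ C, ‖q y - q z‖ ≤ K * ‖p y - p z‖) :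
    μHE[2] (q '' C) ≤ ENNReal.ofReal (K ^ 2) * μHE[2] (p '' C) := by
  set r : Space → Space := q ∘ Function.invFunOn p C
  have hr : ∀ y ∈ C, r (p y) = q y := by
    intro y hy
    have hmem := Function.invFunOn_mem (f := p) ⟨y, hy, rfl⟩
    have heq := Function.invFunOn_eq (f := p) ⟨y, hy, rfl⟩
    have := h _ hmem y hy
    rw [heq, sub_self, norm_zero, mul_zero] at this
    exact sub_eq_zero.mp (norm_le_zero_iff.mp this)
  have hlip : LipschitzOnWith K.toNNReal r (p '' C) := by
    refine LipschitzOnWith.of_dist_le_mul ?_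
    rintro _ ⟨y, hy, rfl⟩ _ ⟨z, hz, rfl⟩
    rw [hr y hy, hr z hz, dist_eq_norm, dist_eq_norm, Real.coe_toNNReal _ hK]
    exact h y hy z hz
  have himg : q '' C = r '' (p '' C) := by
    rw [image_image]
    exact image_congr fun y hy => (hr y hy).symm
  have := hlip.hausdorffMeasure_image_le (d := 2) (by norm_num)
  rw [himg, Measure.euclideanHausdorffMeasure_def]
  simp only [Measure.smul_apply, ENNReal.smul_def, smul_eq_mul, Nat.cast_ofNat]
  rw [mul_left_comm]
  gcongr
  refine this.trans_eq ?_
  congr 1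
  rw [ENNReal.ofReal_pow hK]
  norm_cast

/-- The area factor of a linear map on a plane. -/
lemma area_linear_image {T : Submodule ℝ Space} (hT : finrank ℝ T = 2) (L : Space →L[ℝ] Space)
    {C : Set Space} (hC : C ⊆ T) :
    μHE[2] (L '' C) =
      ENNReal.ofReal ((L : Space →ₗ[ℝ] Space).domRestrict T).normDet * μHE[2] C := by
  have h1 : (Subtype.val '' (Subtype.val ⁻¹' C : Set T) : Set Space) = C :=
    (Subtype.image_preimage_coe (T : Set Space) C).trans (inter_eq_right.mpr hC)
  have h2 := ((L : Space →ₗ[ℝ] Space).domRestrict T).euclideanHausdorffMeasure_image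
    (Subtype.val ⁻¹' C)
  rw [hT] at h2
  have h3 := (isometry_subtype_coe (s := (T : Set Space))).euclideanHausdorffMeasure_image
    (d := 2) (Subtype.val ⁻¹' C)
  have h4 : (((L : Space →ₗ[ℝ] Space).domRestrict T) '' (Subtype.val ⁻¹' C)) = L '' C := by
    conv_rhs => rw [← h1, image_image]
    rfl
  rw [h4] at h2
  rw [h2]
  congr 1
  exact h3.symm.trans (congrArg _ h1)

lemma area_inter_ball_lt_top {T : Submodule ℝ Space} (hT : finrank ℝ T = 2) (r : ℝ) :
    μHE[2] ((T : Set Space) ∩ Metric.closedBall 0 r) < ⊤ := by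
  have h3 := (isometry_subtype_coe (s := (T : Set Space))).euclideanHausdorffMeasure_image
    (d := 2) (Metric.closedBall (0 : T) r)
  have h4 : (Subtype.val '' (Metric.closedBall (0 : T) r) : Set Space) =
      (T : Set Space) ∩ Metric.closedBall 0 r := by
    ext v
    simp
    tauto
  have h5 : (μHE[finrank ℝ T] : Measure T) (Metric.closedBall (0 : T) r) < ⊤ :=
    (isCompact_closedBall _ _).measure_lt_top
  rw [hT] at h5
  rw [← h4]
  exact h3.trans_lt h5

lemma eventually_norm_le_of_isLittleO {α V : Type*} [NormedAddCommGroup V] {l : Filter α}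
    {u v : α → V} (h : (fun a => u a - v a) =o[l] v) {K : ℝ} (hK : 1 < K) :
    ∀ᶠ a in l, ‖u a‖ ≤ K * ‖v a‖ ∧ ‖v a‖ ≤ K * ‖u a‖ := by
  have hK0 : 0 < K := by linarith
  have hε : 0 < 1 - K⁻¹ := by
    have := inv_lt_one_of_one_lt₀ hK
    linarith
  filter_upwards [h.def hε] with a ha
  have hK1 : K * K⁻¹ = 1 := mul_inv_cancel₀ hK0.ne'
  have hv := norm_nonneg (v a)
  have h1 : ‖u a‖ ≤ ‖u a - v a‖ + ‖v a‖ := by simpa using norm_add_le (u a - v a) (v a)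
  have h2 : ‖v a‖ ≤ ‖u a - v a‖ + ‖u a‖ := by
    have := norm_sub_le (u a) (u a - v a)
    simp only [sub_sub_cancel] at this
    linarith
  constructor
  · have : 1 + (1 - K⁻¹) ≤ K := by nlinarith [inv_pos.mpr hK0]
    nlinarith
  · nlinarith

/-- Near a point with a strictly tangent plane `T`, a map `A` which is `C¹` along the set, with
derivative injective on `T`, changes areas by a factor close to that of its derivative on `T`. -/
lemma eventually_area_image_le {G : Set Space} {A a : Space → Space} {x : Space}
    (hG : HasTangentPlaneAt G x) (ha : ContDiffAt ℝ 1 a x) (hAa : A =ᶠ[𝓝[G] x] a)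
    {c : ℝ} (hc : ∀ v ∈ tangentSpace G x, ‖v‖ ≤ c * ‖fderiv ℝ a x v‖) {K : ℝ} (hK : 1 < K) :
    ∃ U ∈ 𝓝[G] x, ∀ C ⊆ U,
      μHE[2] (A '' C) ≤ ENNReal.ofReal (K * (((fderiv ℝ a x : Space →L[ℝ] Space) :
        Space →ₗ[ℝ] Space).domRestrict (tangentSpace G x)).normDet) * μHE[2] C ∧
      ENNReal.ofReal (((fderiv ℝ a x : Space →L[ℝ] Space) :
        Space →ₗ[ℝ] Space).domRestrict (tangentSpace G x)).normDet * μHE[2] C ≤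
          ENNReal.ofReal K * μHE[2] (A '' C) := by
  set T := tangentSpace G x
  set L := fderiv ℝ a x
  set J := ((L : Space →ₗ[ℝ] Space).domRestrict T).normDet
  -- two Lipschitz comparisons, each with constant `k`, are composed, and areas scale with `k ^ 2`
  obtain ⟨k, hk1, hkK⟩ : ∃ k : ℝ, 1 < k ∧ (k ^ 2) * (k ^ 2) ≤ K := by
    refine ⟨√(√K), ?_, ?_⟩
    · rw [Real.lt_sqrt zero_le_one, Real.lt_sqrt (by positivity)]
      simpa using hK
    · rw [Real.sq_sqrt (Real.sqrt_nonneg _), ← pow_two, Real.sq_sqrt (by linarith)]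
  have hk0 : 0 ≤ k := by linarith
  have hk2 : 1 ≤ k ^ 2 := one_le_pow₀ hk1.le
  have hkK' : k ^ 2 ≤ K := by nlinarith
  have e1 : ∀ᶠ p : Space × Space in 𝓝[G ×ˢ G] (x, x),
      ‖T.starProjection (p.1 - p.2)‖ ≤ k * ‖p.1 - p.2‖ ∧
        ‖p.1 - p.2‖ ≤ k * ‖T.starProjection (p.1 - p.2)‖ := by
    refine eventually_norm_le_of_isLittleO
      (u := fun p : Space × Space => T.starProjection (p.1 - p.2)) ?_ hk1
    refine (IsLittleO.neg_left hG.strict).congr_left fun p => ?_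
    abel
  have hO : (fun p : Space × Space => p.1 - p.2) =O[𝓝[G ×ˢ G] (x, x)]
      fun p => L (T.starProjection (p.1 - p.2)) := by
    refine IsBigO.of_bound (k * c) ?_
    filter_upwards [e1] with p hp
    refine hp.2.trans ?_
    rw [mul_assoc]
    gcongr
    exact hc _ (Submodule.starProjection_apply_mem _ _)
  have e2 : ∀ᶠ p : Space × Space in 𝓝[G ×ˢ G] (x, x),
      ‖A p.1 - A p.2‖ ≤ k * ‖L (T.starProjection (p.1 - p.2))‖ ∧
        ‖L (T.starProjection (p.1 - p.2))‖ ≤ k * ‖A p.1 - A p.2‖ :=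
    eventually_norm_le_of_isLittleO
      ((isLittleO_sub_fderiv_starProjection hG.strict ha hAa).trans_isBigO hO) hk1
  have e3 := e1.and e2
  rw [nhdsWithin_prod_eq] at e3
  obtain ⟨U, hU, hUU⟩ := mem_prod_self_iff.mp e3
  refine ⟨U, hU, fun C hC => ?_⟩
  have hUU' : ∀ y ∈ C, ∀ z ∈ C, _ := fun y hy z hz => hUU (mk_mem_prod (hC hy) (hC hz))
  have hlin : μHE[2] ((fun y => L (T.starProjection y)) '' C) =
      ENNReal.ofReal J * μHE[2] (T.starProjection '' C) := by
    rw [← area_linear_image hG.finrank_eq L (C := T.starProjection '' C), image_image]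
    rintro _ ⟨y, -, rfl⟩
    exact Submodule.starProjection_apply_mem _ _
  have f1 : μHE[2] (T.starProjection '' C) ≤ μHE[2] C := by
    have := area_image_le_of_norm_sub_le (p := id) (q := T.starProjection) (C := C) zero_le_one
      (fun y _ z _ => by
        rw [← map_sub, one_mul]
        exact Submodule.norm_starProjection_apply_le _ _)
    simpa using this
  have f2 : μHE[2] C ≤ ENNReal.ofReal (k ^ 2) * μHE[2] (T.starProjection '' C) := by
    have := area_image_le_of_norm_sub_le (p := T.starProjection) (q := id) (C := C) hk0
      (fun y hy z hz => by
        rw [← map_sub]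
        exact (hUU' y hy z hz).1.2)
    simpa using this
  have f3 : μHE[2] (A '' C) ≤
      ENNReal.ofReal (k ^ 2) * μHE[2] ((fun y => L (T.starProjection y)) '' C) :=
    area_image_le_of_norm_sub_le hk0 (fun y hy z hz => by
        rw [← map_sub, ← map_sub]
        exact (hUU' y hy z hz).2.1)
  have f4 : μHE[2] ((fun y => L (T.starProjection y)) '' C) ≤
      ENNReal.ofReal (k ^ 2) * μHE[2] (A '' C) :=
    area_image_le_of_norm_sub_le hk0 (fun y hy z hz => by
        rw [← map_sub, ← map_sub]
        exact (hUU' y hy z hz).2.2)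
  rw [hlin] at f3 f4
  constructor
  · refine f3.trans ?_
    rw [ENNReal.ofReal_mul (by linarith), mul_assoc]
    gcongr
  · calc ENNReal.ofReal J * μHE[2] C
        ≤ ENNReal.ofReal J * (ENNReal.ofReal (k ^ 2) * μHE[2] (T.starProjection '' C)) := by gcongr
      _ = ENNReal.ofReal (k ^ 2) * (ENNReal.ofReal J * μHE[2] (T.starProjection '' C)) := by ring
      _ ≤ ENNReal.ofReal (k ^ 2) * (ENNReal.ofReal (k ^ 2) * μHE[2] (A '' C)) := by gcongr
      _ ≤ ENNReal.ofReal K * μHE[2] (A '' C) := by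
          rw [← mul_assoc, ← ENNReal.ofReal_mul (by positivity)]
          gcongr

lemma HasTangentPlaneAt.exists_area_lt_top {G : Set Space} {x : Space}
    (hG : HasTangentPlaneAt G x) : ∃ U ∈ 𝓝[G] x, μHE[2] U < ⊤ := by
  have e1 : ∀ᶠ p : Space × Space in 𝓝[G ×ˢ G] (x, x),
      ‖(tangentSpace G x).starProjection (p.1 - p.2)‖ ≤ 2 * ‖p.1 - p.2‖ ∧
        ‖p.1 - p.2‖ ≤ 2 * ‖(tangentSpace G x).starProjection (p.1 - p.2)‖ := by
    refine eventually_norm_le_of_isLittleO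
      (u := fun p : Space × Space => (tangentSpace G x).starProjection (p.1 - p.2)) ?_ one_lt_two
    refine (IsLittleO.neg_left hG.strict).congr_left fun p => ?_
    abel
  rw [nhdsWithin_prod_eq] at e1
  obtain ⟨U, hU, hUU⟩ := mem_prod_self_iff.mp e1
  refine ⟨U ∩ Metric.closedBall x 1,
    inter_mem hU (mem_nhdsWithin_of_mem_nhds (Metric.closedBall_mem_nhds x one_pos)), ?_⟩
  have h := area_image_le_of_norm_sub_le (p := (tangentSpace G x).starProjection) (q := id)
    (C := U ∩ Metric.closedBall x 1) zero_le_two (fun y hy z hz => by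
      rw [← map_sub]
      exact (hUU (mk_mem_prod hy.1 hz.1)).2)
  rw [image_id] at h
  refine h.trans_lt (ENNReal.mul_lt_top ENNReal.ofReal_lt_top ?_)
  refine (measure_mono ?_).trans_lt (area_inter_ball_lt_top hG.finrank_eq (‖x‖ + 1))
  rintro _ ⟨y, hy, rfl⟩
  refine ⟨Submodule.starProjection_apply_mem _ _, ?_⟩
  rw [mem_closedBall_zero_iff]
  refine (Submodule.norm_starProjection_apply_le _ _).trans ?_
  have h1 : ‖y - x‖ ≤ 1 := by simpa [dist_eq_norm] using hy.2
  have h2 := norm_add_le (y - x) x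
  rw [sub_add_cancel] at h2
  linarith

lemma area_lt_top_of_isCompact {F : Set Space} (hF : IsCompact F)
    (h : ∀ x ∈ F, HasTangentPlaneAt F x) : μHE[2] F < ⊤ :=
  hF.measure_lt_top_of_nhdsWithin fun x hx => by
    obtain ⟨U, hU, hlt⟩ := (h x hx).exists_area_lt_top
    exact ⟨U, hU, hlt⟩

/-! ### The area formula on sets with tangent planes -/

lemma restrict_le_restrict_of_locally_le {μ ν : Measure Space} {G : Set Space}
    (hG : MeasurableSet G)
    (h : ∀ x ∈ G, ∃ U ∈ 𝓝[G] x, ∀ C ⊆ U, C ⊆ G → MeasurableSet C → μ C ≤ ν C) :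
    μ.restrict G ≤ ν.restrict G := by
  choose! U hU hUle using h
  have hW : ∀ x ∈ G, ∃ W, IsOpen W ∧ x ∈ W ∧ W ∩ G ⊆ U x := fun x hx =>
    mem_nhdsWithin.mp (hU x hx)
  choose! W hWo hxW hWU using hW
  obtain ⟨t, htG, htc, hcov⟩ := TopologicalSpace.countable_cover_nhdsWithin
    (s := G) (f := W) fun x hx => mem_nhdsWithin_of_mem_nhds ((hWo x hx).mem_nhds (hxW x hx))
  rcases t.eq_empty_or_nonempty with rfl | hne
  · have : G = ∅ := by simpa using hcov
    simp [this]
  obtain ⟨f, rfl⟩ := htc.exists_eq_range hne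
  have hfG : ∀ n, f n ∈ G := fun n => htG (mem_range_self n)
  rw [biUnion_range] at hcov
  set V : ℕ → Set Space := fun n => W (f n)
  have hVm : ∀ n, MeasurableSet (V n) := fun n => (hWo _ (hfG n)).measurableSet
  refine Measure.le_iff.mpr fun C hC => ?_
  rw [Measure.restrict_apply hC, Measure.restrict_apply hC]
  have hCU : C ∩ G = ⋃ n, (C ∩ G) ∩ disjointed V n := by
    rw [← inter_iUnion, iUnion_disjointed, eq_comm, inter_eq_left]
    exact inter_subset_right.trans hcov
  have hm : ∀ n, MeasurableSet ((C ∩ G) ∩ disjointed V n) := fun n =>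
    (hC.inter hG).inter (MeasurableSet.disjointed hVm n)
  have hd : Pairwise (Function.onFun Disjoint fun n => (C ∩ G) ∩ disjointed V n) :=
    fun i j hij => (disjoint_disjointed V hij).mono inter_subset_right inter_subset_right
  rw [hCU, measure_iUnion hd hm, measure_iUnion hd hm]
  refine ENNReal.tsum_le_tsum fun n => hUle (f n) (hfG n) _ ?_ ?_ (hm n)
  · exact fun y hy => hWU _ (hfG n) ⟨disjointed_subset V n hy.2, hy.1.2⟩
  · exact fun y hy => hy.1.2

lemma le_of_forall_one_lt_le_mul {a b : ENNReal}
    (h : ∀ K : ℝ, 1 < K → a ≤ ENNReal.ofReal (K ^ 2) * b) : a ≤ b := by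
  have h1 : Tendsto (fun K : ℝ => ENNReal.ofReal (K ^ 2) * b) (𝓝[>] 1) (𝓝 b) := by
    have h2 : Tendsto (fun K : ℝ => ENNReal.ofReal (K ^ 2)) (𝓝[>] 1) (𝓝 1) := by
      have : Continuous fun K : ℝ => ENNReal.ofReal (K ^ 2) :=
        ENNReal.continuous_ofReal.comp (continuous_pow 2)
      simpa using (this.tendsto 1).mono_left nhdsWithin_le_nhds
    simpa using ENNReal.Tendsto.mul_const h2 (Or.inl one_ne_zero)
  exact ge_of_tendsto h1 (eventually_nhdsWithin_of_forall h)

/-- `J` is the Jacobian of `A` along `G`: the area factor of the derivative of `A` on the tangent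
planes of `G`. -/
def IsTangentialJacobian (G : Set Space) (A : Space → Space) (J : Space → ℝ) : Prop :=
  ∀ x ∈ G, ∃ a : Space → Space, ContDiffAt ℝ 1 a x ∧ A =ᶠ[𝓝[G] x] a ∧
    (((fderiv ℝ a x : Space →L[ℝ] Space) :
      Space →ₗ[ℝ] Space).domRestrict (tangentSpace G x)).normDet = J x

lemma IsC1DiffeoOn.measurableSet_image {G : Set Space} {A B : Space → Space}
    (h : IsC1DiffeoOn G A B) (hGm : MeasurableSet G) : MeasurableSet (A '' G) :=
  hGm.image_of_continuousOn_injOn h.continuousOn h.injOn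

/-- The area formula: `A` pushes the measure with density its Jacobian forward to the area of the
image. -/
lemma IsC1DiffeoOn.map_withDensity {G : Set Space} {A B : Space → Space}
    (h : IsC1DiffeoOn G A B) (hG : ∀ x ∈ G, HasTangentPlaneAt G x) (hGm : MeasurableSet G)
    {J : Space → ℝ} (hJ : IsTangentialJacobian G A J) (hJc : ContinuousOn J G)
    (hJ0 : ∀ x ∈ G, 0 < J x) :
    ((surfaceMeasure G).withDensity fun x => ENNReal.ofReal (J x)).map A =
      surfaceMeasure (A '' G) := by
  classical
  have hG'm := h.measurableSet_image hGm
  set A' : Space → Space := G.piecewise A fun _ => 0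
  set B' : Space → Space := (A '' G).piecewise B fun _ => 0
  have hA' : Measurable A' := h.continuousOn.measurable_piecewise continuousOn_const hGm
  have hB' : Measurable B' := h.symm.continuousOn.measurable_piecewise continuousOn_const hG'm
  have hA'eq : EqOn A' A G := fun x hx => piecewise_eq_of_mem _ _ _ hx
  have hB'eq : EqOn B' B (A '' G) := fun x hx => piecewise_eq_of_mem _ _ _ hx
  -- `ν C` is the area of `A '' C`, and the claim is that `ν` has density `J`
  set ν : Measure Space := (surfaceMeasure (A '' G)).map B'
  set ρ : Measure Space := (surfaceMeasure G).withDensity fun x => ENNReal.ofReal (J x)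
  have hν : ∀ C ⊆ G, MeasurableSet C → ν C = μHE[2] (A '' C) := by
    intro C hCG hC
    rw [Measure.map_apply hB' hC, surfaceMeasure, Measure.restrict_apply (hB' hC)]
    congr 1
    ext y
    constructor
    · rintro ⟨hy, hyG⟩
      rw [mem_preimage, hB'eq hyG] at hy
      exact ⟨B y, hy, h.symm.leftInvOn hyG⟩
    · rintro ⟨x, hx, rfl⟩
      have hm := mem_image_of_mem A (hCG hx)
      refine ⟨?_, hm⟩
      rw [mem_preimage, hB'eq hm, h.leftInvOn (hCG hx)]
      exact hx
  have hρ : ∀ C ⊆ G, MeasurableSet C → ρ C = ∫⁻ x in C, ENNReal.ofReal (J x) ∂μHE[2] := by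
    intro C hCG hC
    rw [withDensity_apply _ hC, surfaceMeasure, Measure.restrict_restrict hC,
      inter_eq_left.mpr hCG]
  have hνG : ν.restrict G = ν := by
    refine Measure.restrict_eq_self_of_ae_mem ?_
    refine (ae_map_iff hB'.aemeasurable hGm).mpr ?_
    refine (ae_restrict_iff' hG'm).mpr (Eventually.of_forall ?_)
    rintro _ ⟨x, hx, rfl⟩
    rwa [hB'eq (mem_image_of_mem A hx), h.leftInvOn hx]
  have hρG : ρ.restrict G = ρ := by
    refine Measure.restrict_eq_self_of_ae_mem ?_
    exact (withDensity_absolutelyContinuous _ _).ae_le (ae_restrict_mem hGm)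
  -- locally, `J` is almost constant and `ν` is almost `J x` times the area
  have key : ∀ K : ℝ, 1 < K → ∀ x ∈ G, ∃ U ∈ 𝓝[G] x, ∀ C ⊆ U, C ⊆ G → MeasurableSet C →
      ν C ≤ ENNReal.ofReal (K ^ 2) * ρ C ∧ ρ C ≤ ENNReal.ofReal (K ^ 2) * ν C := by
    intro K hK x hx
    have hK0 : 0 < K := by linarith
    obtain ⟨a, ha, hAa, hJa⟩ := hJ x hx
    obtain ⟨b, hb, hBb⟩ := h.c1_inv (A x) (mem_image_of_mem A hx)
    obtain ⟨-, -, hKL, -⟩ := tangentSpace_image hx h (hasFDerivWithinAt_of_eventuallyEq hx ha hAa)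
      (hasFDerivWithinAt_of_eventuallyEq (mem_image_of_mem A hx) hb hBb)
    obtain ⟨U, hU, hUC⟩ := eventually_area_image_le (hG x hx) ha hAa
      (c := ‖fderiv ℝ b (A x)‖) (fun v hv => by
        conv_lhs => rw [← hKL v hv]
        exact ContinuousLinearMap.le_opNorm _ _) hK
    rw [hJa] at hUC
    have hJx := hJ0 x hx
    have hJ1 : ∀ᶠ y in 𝓝[G] x, J y < K * J x :=
      (hJc x hx).eventually_lt continuousWithinAt_const (by nlinarith)
    have hJ2 : ∀ᶠ y in 𝓝[G] x, J x < K * J y :=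
      continuousWithinAt_const.eventually_lt
        (ContinuousWithinAt.fun_mul continuousWithinAt_const (hJc x hx)) (by nlinarith)
    refine ⟨_, inter_mem hU (hJ1.and hJ2), fun C hC hCG hCm => ?_⟩
    obtain ⟨hc1, hc2⟩ := hUC C (hC.trans inter_subset_left)
    rw [hν C hCG hCm, hρ C hCG hCm]
    have hsq : ENNReal.ofReal (K ^ 2) = ENNReal.ofReal K * ENNReal.ofReal K := by
      rw [pow_two, ENNReal.ofReal_mul hK0.le]
    constructor
    · refine hc1.trans ?_
      rw [ENNReal.ofReal_mul hK0.le, hsq, mul_assoc, mul_assoc]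
      refine mul_le_mul_right ?_ _
      rw [← setLIntegral_const, ← lintegral_const_mul' _ _ ENNReal.ofReal_ne_top]
      refine setLIntegral_mono' hCm fun y hy => ?_
      rw [← ENNReal.ofReal_mul hK0.le]
      exact ENNReal.ofReal_le_ofReal (hC hy).2.2.le
    · calc ∫⁻ y in C, ENNReal.ofReal (J y) ∂μHE[2]
          ≤ ∫⁻ _ in C, ENNReal.ofReal (K * J x) ∂μHE[2] :=
            setLIntegral_mono' hCm fun y hy => ENNReal.ofReal_le_ofReal (hC hy).2.1.le
        _ = ENNReal.ofReal K * (ENNReal.ofReal (J x) * μHE[2] C) := by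
            rw [setLIntegral_const, ENNReal.ofReal_mul hK0.le, mul_assoc]
        _ ≤ ENNReal.ofReal K * (ENNReal.ofReal K * μHE[2] (A '' C)) := by gcongr
        _ = _ := by rw [hsq, mul_assoc]
  have hνρ : ν = ρ := by
    rw [← hνG, ← hρG]
    apply le_antisymm
    · refine Measure.le_iff.mpr fun s _ => le_of_forall_one_lt_le_mul fun K hK => ?_
      have := restrict_le_restrict_of_locally_le (μ := ν) (ν := ENNReal.ofReal (K ^ 2) • ρ) hGm
        (fun x hx => by
          obtain ⟨U, hU, hUC⟩ := key K hK x hx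
          exact ⟨U, hU, fun C hC hCG hCm => (hUC C hC hCG hCm).1⟩)
      have := this s
      rwa [Measure.restrict_smul] at this
    · refine Measure.le_iff.mpr fun s _ => le_of_forall_one_lt_le_mul fun K hK => ?_
      have := restrict_le_restrict_of_locally_le (μ := ρ) (ν := ENNReal.ofReal (K ^ 2) • ν) hGm
        (fun x hx => by
          obtain ⟨U, hU, hUC⟩ := key K hK x hx
          exact ⟨U, hU, fun C hC hCG hCm => (hUC C hC hCG hCm).2⟩)
      have := this s
      rwa [Measure.restrict_smul] at this
  have hAA' : A =ᵐ[ρ] A' := by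
    have : ∀ᵐ x ∂ρ, x ∈ G :=
      (withDensity_absolutelyContinuous _ _).ae_le (ae_restrict_mem hGm)
    filter_upwards [this] with x hx
    exact (hA'eq hx).symm
  rw [Measure.map_congr hAA', ← hνρ, Measure.map_map hA' hB']
  have hid : A' ∘ B' =ᵐ[surfaceMeasure (A '' G)] id := by
    refine (ae_restrict_iff' hG'm).mpr (Eventually.of_forall ?_)
    rintro _ ⟨x, hx, rfl⟩
    rw [Function.comp_apply, hB'eq (mem_image_of_mem A hx), h.leftInvOn hx, hA'eq hx, id]
  rw [Measure.map_congr hid, Measure.map_id]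

/-- Change of variables, for integrals and for integrability. -/
lemma IsC1DiffeoOn.integral_image {G : Set Space} {A B : Space → Space}
    (h : IsC1DiffeoOn G A B) (hG : ∀ x ∈ G, HasTangentPlaneAt G x) (hGm : MeasurableSet G)
    {J : Space → ℝ} (hJ : IsTangentialJacobian G A J) (hJc : ContinuousOn J G)
    (hJ0 : ∀ x ∈ G, 0 < J x) {φ : Space → ℝ}
    (hφ : AEStronglyMeasurable φ (surfaceMeasure (A '' G))) :
    AEStronglyMeasurable (fun y => φ (A y)) (surfaceMeasure G) ∧
    (Integrable φ (surfaceMeasure (A '' G)) ↔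
      Integrable (fun y => J y * φ (A y)) (surfaceMeasure G)) ∧
    ∫ x, φ x ∂surfaceMeasure (A '' G) = ∫ y, J y * φ (A y) ∂surfaceMeasure G := by
  have hmap := h.map_withDensity hG hGm hJ hJc hJ0
  set ρ : Measure Space := (surfaceMeasure G).withDensity fun x => ENNReal.ofReal (J x)
  have hJm : AEMeasurable J (surfaceMeasure G) := hJc.aemeasurable hGm
  have hAm : AEMeasurable A (surfaceMeasure G) := h.continuousOn.aemeasurable hGm
  have hAρ : AEMeasurable A ρ := hAm.mono_ac (withDensity_absolutelyContinuous _ _)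
  have hac : surfaceMeasure G ≪ ρ := by
    refine withDensity_absolutelyContinuous' hJm.ennreal_ofReal ?_
    filter_upwards [ae_restrict_mem hGm] with x hx
    simpa using hJ0 x hx
  have hJeq : ∀ᵐ x ∂surfaceMeasure G, (ENNReal.ofReal (J x)).toReal = J x := by
    filter_upwards [ae_restrict_mem hGm] with x hx
    exact ENNReal.toReal_ofReal (hJ0 x hx).le
  rw [← hmap] at hφ ⊢
  have hφA : AEStronglyMeasurable (fun y => φ (A y)) ρ := hφ.comp_aemeasurable hAρ
  refine ⟨hφA.mono_ac hac, ?_, ?_⟩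
  · rw [integrable_map_measure hφ hAρ,
      integrable_withDensity_iff_integrable_smul₀' hJm.ennreal_ofReal
        (Eventually.of_forall fun _ => ENNReal.ofReal_lt_top)]
    refine integrable_congr ?_
    filter_upwards [hJeq] with y hy
    rw [hy, smul_eq_mul, Function.comp_apply]
  · rw [integral_map hAρ hφ, integral_withDensity_eq_integral_toReal_smul₀ hJm.ennreal_ofReal
        (Eventually.of_forall fun _ => ENNReal.ofReal_lt_top)]
    refine integral_congr_ae ?_
    filter_upwards [hJeq] with y hy
    rw [hy, smul_eq_mul]

/-! ### Surface gradient and Jacobian of a displacement along `e3` -/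

lemma norm_e3 : ‖e3‖ = 1 := by simp [e3]

/-- The tangential gradient of the scalar function `u`. The surface gradient of `(0, 0, u)` has
rank one, and this vector is its value at `e3`. -/
def tangentialGradient (S : Set Space) (u : Space → ℝ) (x : Space) : Space :=
  surfaceGradient S (meshVelocity u) x e3

lemma surfaceGradient_eq_rankOne {S : Set Space} {u U : Space → ℝ} {x : Space} (hx : x ∈ S)
    (hU : ContDiffAt ℝ 1 U x) (h : u =ᶠ[𝓝[S] x] U) :
    surfaceGradient S (meshVelocity u) x =
      InnerProductSpace.rankOne ℝ (tangentProj S x (gradient U x)) e3 := by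
  have h1 : HasFDerivWithinAt (meshVelocity u) ((fderiv ℝ U x).smulRight e3) S x :=
    (hasFDerivWithinAt_of_eventuallyEq hx hU h).smul_const e3
  have h2 := h1.differentiableWithinAt.hasFDerivWithinAt
  have h3 := eqOn_tangentSpace h2 h1
  have hsymm : ∀ v w : Space, inner ℝ (tangentProj S x v) w = inner ℝ v (tangentProj S x w) :=
    fun v w => (tangentSpace S x).inner_starProjection_left_eq_right v w
  ext1 v
  refine ext_inner_right ℝ fun w => ?_
  have hw : tangentProj S x w ∈ tangentSpace S x := Submodule.starProjection_apply_mem _ _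
  rw [surfaceGradient, ContinuousLinearMap.comp_apply, hsymm,
    ContinuousLinearMap.adjoint_inner_left,
    h3 _ hw, InnerProductSpace.rankOne_apply,
    inner_smul_left, hsymm, ContinuousLinearMap.smulRight_apply, inner_smul_right, gradient,
    InnerProductSpace.toDual_symm_apply, real_inner_comm]
  simp only [conj_trivial]
  ring

lemma tangentialGradient_eq {S : Set Space} {u U : Space → ℝ} {x : Space} (hx : x ∈ S)
    (hU : ContDiffAt ℝ 1 U x) (h : u =ᶠ[𝓝[S] x] U) :
    tangentialGradient S u x = tangentProj S x (gradient U x) := by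
  rw [tangentialGradient, surfaceGradient_eq_rankOne hx hU h, InnerProductSpace.rankOne_apply,
    real_inner_self_eq_norm_sq, norm_e3, one_pow, one_smul]

lemma surfaceDiv_eq_inner {S : Set Space} {u : Space → ℝ} {x : Space} (hx : x ∈ S)
    (hu : IsC1WithinAt u S x) :
    surfaceDiv S (meshVelocity u) x = inner ℝ e3 (tangentialGradient S u x) := by
  obtain ⟨U, hU, h⟩ := hu
  rw [surfaceDiv, tangentialGradient_eq hx hU h, surfaceGradient_eq_rankOne hx hU h,
    InnerProductSpace.trace_rankOne]

lemma norm_surfaceGradient {S : Set Space} {u : Space → ℝ} {x : Space} (hx : x ∈ S)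
    (hu : IsC1WithinAt u S x) :
    ‖surfaceGradient S (meshVelocity u) x‖ = ‖tangentialGradient S u x‖ := by
  obtain ⟨U, hU, h⟩ := hu
  rw [tangentialGradient_eq hx hU h, surfaceGradient_eq_rankOne hx hU h,
    InnerProductSpace.norm_rankOne, norm_e3, mul_one]

lemma inner_tangentialGradient {S : Set Space} {u U : Space → ℝ} {x : Space} (hx : x ∈ S)
    (hU : ContDiffAt ℝ 1 U x) (h : u =ᶠ[𝓝[S] x] U) {v : Space} (hv : v ∈ tangentSpace S x) :
    inner ℝ (tangentialGradient S u x) v = fderiv ℝ U x v := by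
  rw [tangentialGradient_eq hx hU h, tangentProj, Submodule.inner_starProjection_left_eq_right,
    Submodule.starProjection_eq_self_iff.mpr hv, gradient, InnerProductSpace.toDual_symm_apply]

lemma tangentialGradient_mem {S : Set Space} {u : Space → ℝ} {x : Space} (hx : x ∈ S)
    (hu : IsC1WithinAt u S x) : tangentialGradient S u x ∈ tangentSpace S x := by
  obtain ⟨U, hU, h⟩ := hu
  rw [tangentialGradient_eq hx hU h]
  exact Submodule.starProjection_apply_mem _ _

lemma norm_tangentialGradient_le {S : Set Space} {u U : Space → ℝ} {x : Space} (hx : x ∈ S)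
    (hU : ContDiffAt ℝ 1 U x) (h : u =ᶠ[𝓝[S] x] U) :
    ‖tangentialGradient S u x‖ ≤ ‖fderiv ℝ U x‖ := by
  rw [tangentialGradient_eq hx hU h]
  refine (Submodule.norm_starProjection_apply_le _ _).trans_eq ?_
  rw [gradient, LinearIsometryEquiv.norm_map]

lemma continuousOn_tangentialGradient {S : Set Space} {u : Space → ℝ}
    (hS : ∀ x ∈ S, HasTangentPlaneAt S x) (hu : ∀ x ∈ S, IsC1WithinAt u S x) :
    ContinuousOn (tangentialGradient S u) S := by
  intro x hx
  obtain ⟨U, hU, h⟩ := hu x hx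
  have hc : ContinuousWithinAt (fun y => tangentProj S y (gradient U y)) S x :=
    (hS x hx).cont.clm_apply
      (((InnerProductSpace.toDual ℝ Space).symm.continuous.continuousAt.comp
        (hU.continuousAt_fderiv one_ne_zero)).continuousWithinAt)
  refine hc.congr_of_eventuallyEq ?_ (tangentialGradient_eq hx hU h)
  filter_upwards [eventually_eventually_nhdsWithin.mpr h,
    (hU.eventually (by simp)).filter_mono nhdsWithin_le_nhds, self_mem_nhdsWithin] with y h1 h2 h3
  exact tangentialGradient_eq h3 h2 h1

/-- The Jacobian of `y ↦ y + δ (0, 0, u(y))` along `S`. The second summand is the part of the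
displaced area element that is orthogonal to the old normal. -/
def aleJacobian (S : Set Space) (u : Space → ℝ) (δ : ℝ) (x : Space) : ℝ :=
  √((1 + δ * inner ℝ e3 (tangentialGradient S u x)) ^ 2 +
    δ ^ 2 * ((1 - ‖tangentProj S x e3‖ ^ 2) * ‖tangentialGradient S u x‖ ^ 2))

lemma one_sub_norm_tangentProj_sq_nonneg (S : Set Space) (x : Space) :
    0 ≤ 1 - ‖tangentProj S x e3‖ ^ 2 := by
  have h := (tangentSpace S x).norm_starProjection_apply_le e3
  rw [norm_e3] at h
  have := norm_nonneg (tangentProj S x e3)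
  rw [tangentProj] at *
  nlinarith

lemma one_add_le_aleJacobian (S : Set Space) (u : Space → ℝ) (δ : ℝ) (x : Space) :
    1 + δ * inner ℝ e3 (tangentialGradient S u x) ≤ aleJacobian S u δ x := by
  apply Real.le_sqrt_of_sq_le
  have := mul_nonneg (sq_nonneg δ) (mul_nonneg (one_sub_norm_tangentProj_sq_nonneg S x)
    (sq_nonneg ‖tangentialGradient S u x‖))
  linarith

lemma aleJacobian_le {S : Set Space} {u : Space → ℝ} {δ : ℝ} {x : Space}
    (h : |δ| * ‖tangentialGradient S u x‖ ≤ 1 / 2) :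
    aleJacobian S u δ x ≤ 1 + δ * inner ℝ e3 (tangentialGradient S u x) +
      δ ^ 2 * ‖tangentialGradient S u x‖ ^ 2 := by
  set g := tangentialGradient S u x
  have h1 : |inner ℝ e3 g| ≤ ‖g‖ := by simpa [norm_e3] using abs_real_inner_le_norm e3 g
  have h2 : |δ * inner ℝ e3 g| ≤ 1 / 2 := by
    rw [abs_mul]
    exact (mul_le_mul_of_nonneg_left h1 (abs_nonneg δ)).trans h
  have h3 := (abs_le.mp h2).1
  have h4 : 0 ≤ δ ^ 2 * ‖g‖ ^ 2 := by positivity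
  have h5 : δ ^ 2 * ((1 - ‖tangentProj S x e3‖ ^ 2) * ‖g‖ ^ 2) ≤ δ ^ 2 * ‖g‖ ^ 2 := by
    nlinarith [mul_nonneg h4 (sq_nonneg ‖tangentProj S x e3‖)]
  apply Real.sqrt_le_iff.mpr
  constructor
  · linarith
  · nlinarith

lemma continuousOn_aleJacobian {S : Set Space} {u : Space → ℝ} (δ : ℝ)
    (hS : ∀ x ∈ S, HasTangentPlaneAt S x) (hu : ∀ x ∈ S, IsC1WithinAt u S x) :
    ContinuousOn (aleJacobian S u δ) S := by
  have hg := continuousOn_tangentialGradient hS hu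
  have hP : ContinuousOn (fun x => tangentProj S x e3) S := fun x hx =>
    (hS x hx).cont.clm_apply continuousWithinAt_const
  unfold aleJacobian
  fun_prop

/-- The area factor of the derivative of the displacement on a plane `T`, from the Gram determinant
of the images of an orthonormal basis of `T`. -/
lemma normDet_displacement {T : Submodule ℝ Space} (hT : finrank ℝ T = 2) {L : Space →L[ℝ] Space}
    {δ : ℝ} {g : Space} (hg : g ∈ T) (hL : ∀ v ∈ T, L v = v + δ • inner ℝ g v • e3) :
    ((L : Space →ₗ[ℝ] Space).domRestrict T).normDet ^ 2 =
      (1 + δ * inner ℝ e3 g) ^ 2 + δ ^ 2 * ((1 - ‖T.starProjection e3‖ ^ 2) * ‖g‖ ^ 2) := by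
  let b : OrthonormalBasis (Fin 2) ℝ T := (stdOrthonormalBasis ℝ T).reindex (finCongr hT)
  have hdet := ((L : Space →ₗ[ℝ] Space).domRestrict T).normDet_sq_eq_det_gram b
  have he : inner ℝ e3 e3 = (1 : ℝ) := by rw [real_inner_self_eq_norm_sq, norm_e3, one_pow]
  have hb : ∀ i j, inner ℝ (b i : Space) (b j : Space) = if i = j then (1 : ℝ) else 0 := by
    intro i j
    rw [← Submodule.coe_inner]
    exact orthonormal_iff_ite.mp b.orthonormal i j
  -- inner products of vectors of `T` in the basis
  have hsum : ∀ v w : T, inner ℝ (v : Space) (w : Space) =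
      inner ℝ (v : Space) (b 0) * inner ℝ (b 0 : Space) w +
        inner ℝ (v : Space) (b 1) * inner ℝ (b 1 : Space) w := by
    intro v w
    have := b.sum_inner_mul_inner v w
    rw [Fin.sum_univ_two] at this
    exact this.symm
  have hproj : ∀ v : T, inner ℝ (v : Space) (T.starProjection e3) = inner ℝ (v : Space) e3 := by
    intro v
    rw [← Submodule.inner_starProjection_left_eq_right,
      Submodule.starProjection_eq_self_iff.mpr v.2]
  have hgg := hsum ⟨g, hg⟩ ⟨g, hg⟩
  have hge := hsum ⟨g, hg⟩ ⟨_, T.starProjection_apply_mem e3⟩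
  have hee := hsum ⟨_, T.starProjection_apply_mem e3⟩ ⟨_, T.starProjection_apply_mem e3⟩
  simp only [hproj ⟨g, hg⟩, hproj (b 0), hproj (b 1)] at hge hee
  simp only [real_inner_comm _ (T.starProjection e3), hproj (b 0), hproj (b 1)] at hee
  simp only [real_inner_comm g (b _ : Space)] at hgg hge
  have hentry : ∀ i j, Matrix.gram ℝ (fun i => (L : Space →ₗ[ℝ] Space).domRestrict T (b i)) i j =
      (if i = j then (1 : ℝ) else 0) + δ * inner ℝ g (b j : Space) * inner ℝ (b i : Space) e3 +
        δ * inner ℝ g (b i : Space) * inner ℝ (b j : Space) e3 +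
        δ ^ 2 * inner ℝ g (b i : Space) * inner ℝ g (b j : Space) := by
    intro i j
    rw [Matrix.gram_apply, LinearMap.domRestrict_apply, LinearMap.domRestrict_apply,
      ContinuousLinearMap.coe_coe, hL _ (b i).2, hL _ (b j).2]
    simp only [inner_add_left, inner_add_right, inner_smul_left, inner_smul_right, hb, he,
      conj_trivial, real_inner_comm (b j : Space) e3]
    ring
  rw [Matrix.det_fin_two] at hdet
  simp only [hentry] at hdet
  simp only [if_true, Fin.isValue, zero_ne_one, one_ne_zero, if_false, zero_add] at hdet
  rw [real_inner_self_eq_norm_sq] at hgg hee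
  rw [real_inner_comm, hge, hgg, hee]
  refine Eq.trans ?_ (hdet.trans ?_)
  · rfl
  · ring

lemma contDiffAt_ale {U : Space → ℝ} {x : Space} (hU : ContDiffAt ℝ 1 U x) (δ : ℝ) :
    ContDiffAt ℝ 1 (ale U δ) x := by
  have : ContDiffAt ℝ 1 (fun y => y + δ • (U y • e3)) x := by fun_prop
  exact this

lemma fderiv_ale {U : Space → ℝ} {x : Space} (hU : ContDiffAt ℝ 1 U x) (δ : ℝ) :
    fderiv ℝ (ale U δ) x =
      ContinuousLinearMap.id ℝ Space + δ • (fderiv ℝ U x).smulRight e3 :=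
  ((hasFDerivAt_id x).add
    (((hU.differentiableAt one_ne_zero).hasFDerivAt.smul_const e3).const_smul δ)).fderiv

lemma eventuallyEq_ale {l : Filter Space} {u U : Space → ℝ} (h : u =ᶠ[l] U) (δ : ℝ) :
    ale u δ =ᶠ[l] ale U δ := by
  filter_upwards [h] with y hy
  rw [ale, ale, meshVelocity, meshVelocity, hy]

lemma IsC1WithinAt.ale {u : Space → ℝ} {S : Set Space} {x : Space} (h : IsC1WithinAt u S x)
    (δ : ℝ) : IsC1WithinAt (ale u δ) S x := by
  obtain ⟨U, hU, h⟩ := h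
  exact ⟨_, contDiffAt_ale hU δ, eventuallyEq_ale h δ⟩

lemma isTangentialJacobian_aleJacobian {S : Set Space} {u : Space → ℝ} (δ : ℝ)
    (hS : ∀ x ∈ S, HasTangentPlaneAt S x) (hu : ∀ x ∈ S, IsC1WithinAt u S x) :
    IsTangentialJacobian S (ale u δ) (aleJacobian S u δ) := by
  intro x hx
  obtain ⟨U, hU, h⟩ := hu x hx
  refine ⟨ale U δ, ?_, ?_, ?_⟩
  · exact contDiffAt_ale hU δ
  · exact eventuallyEq_ale h δ
  · rw [fderiv_ale hU δ]
    refine (Real.sqrt_eq_iff_mul_self_eq ?_ (LinearMap.normDet_nonneg _)).mpr ?_ |>.symm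
    · exact add_nonneg (sq_nonneg _) (mul_nonneg (sq_nonneg δ)
        (mul_nonneg (one_sub_norm_tangentProj_sq_nonneg S x) (sq_nonneg _)))
    · rw [← pow_two]
      refine (normDet_displacement (hS x hx).finrank_eq
        (tangentialGradient_mem hx ⟨U, hU, h⟩) fun v hv => ?_).symm
      rw [inner_tangentialGradient hx hU h hv]
      rfl

lemma IsC1DiffeoOn.tangentialJacobian_pos {S : Set Space} {A B : Space → Space} {J : Space → ℝ}
    (h : IsC1DiffeoOn S A B) (hJ : IsTangentialJacobian S A J) : ∀ x ∈ S, 0 < J x := by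
  intro x hx
  obtain ⟨a, ha, hAa, hJa⟩ := hJ x hx
  obtain ⟨b, hb, hBb⟩ := h.c1_inv (A x) (mem_image_of_mem A hx)
  obtain ⟨-, -, hKL, -⟩ := tangentSpace_image hx h (hasFDerivWithinAt_of_eventuallyEq hx ha hAa)
    (hasFDerivWithinAt_of_eventuallyEq (mem_image_of_mem A hx) hb hBb)
  rw [← hJa]
  refine lt_of_le_of_ne (LinearMap.normDet_nonneg _) (Ne.symm ?_)
  rw [Ne, LinearMap.normDet_eq_zero_iff_ker_ne_bot, not_not, LinearMap.ker_eq_bot']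
  intro v hv
  have h1 := hKL v v.2
  rw [LinearMap.domRestrict_apply, ContinuousLinearMap.coe_coe] at hv
  rw [hv, map_zero] at h1
  exact Subtype.ext h1.symm

/-- On the displaced surface the gradient of the transported function is at most twice as long,
as long as the displacement has a small gradient. -/
lemma norm_tangentialGradient_image_le {S : Set Space} {u v : Space → ℝ} {δ : ℝ}
    {B : Space → Space} (h : IsC1DiffeoOn S (ale u δ) B) {x : Space} (hx : x ∈ S)
    (hu : IsC1WithinAt u S x) (hv : IsC1WithinAt v (ale u δ '' S) (ale u δ x))
    (huv : ∀ y ∈ S, v (ale u δ y) = u y) (hδ : |δ| * ‖tangentialGradient S u x‖ ≤ 1 / 2) :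
    ‖tangentialGradient (ale u δ '' S) v (ale u δ x)‖ ≤ 2 * ‖tangentialGradient S u x‖ := by
  have hAx := mem_image_of_mem (ale u δ) hx
  have hg' := tangentialGradient_mem hAx hv
  obtain ⟨U, hU, hUu⟩ := hu
  obtain ⟨V, hV, hVv⟩ := hv
  obtain ⟨b, hb, hBb⟩ := h.c1_inv _ hAx
  have hA := hasFDerivWithinAt_of_eventuallyEq hx (contDiffAt_ale hU δ) (eventuallyEq_ale hUu δ)
  obtain ⟨-, hK, -, hLK⟩ := tangentSpace_image hx h hA
    (hasFDerivWithinAt_of_eventuallyEq hAx hb hBb)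
  set g := tangentialGradient S u x
  set g' := tangentialGradient (ale u δ '' S) v (ale u δ x)
  -- `t` is the tangent vector of `S` that the derivative of the displacement maps to `g'`
  set t := fderiv ℝ b (ale u δ x) g'
  have ht := hK g' hg'
  have hLt := hLK g' hg'
  have hcomp : HasFDerivWithinAt u ((fderiv ℝ V (ale u δ x)).comp (fderiv ℝ (ale U δ) x)) S x :=
    ((hasFDerivWithinAt_of_eventuallyEq hAx hV hVv).comp x hA (mapsTo_image _ _)).congr
      (fun y hy => (huv y hy).symm) (huv x hx).symm
  -- the derivative of `v` along `g'` is the derivative of `u` along `t`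
  have hgt : inner ℝ g' g' = inner ℝ g t := by
    rw [inner_tangentialGradient hAx hV hVv hg', inner_tangentialGradient hx hU hUu ht,
      eqOn_tangentSpace (hasFDerivWithinAt_of_eventuallyEq hx hU hUu) hcomp t ht,
      ContinuousLinearMap.comp_apply, hLt]
  have hnt : ‖t‖ ≤ 2 * ‖g'‖ := by
    -- `g'` is `t` displaced by at most half of its length
    have e1 : t = g' - δ • inner ℝ g t • e3 := by
      rw [fderiv_ale hU δ] at hLt
      rw [inner_tangentialGradient hx hU hUu ht]
      exact eq_sub_of_add_eq hLt
    have e2 : ‖δ • inner ℝ g t • e3‖ ≤ 1 / 2 * ‖t‖ := by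
      rw [norm_smul, norm_smul, norm_e3, mul_one, Real.norm_eq_abs, Real.norm_eq_abs]
      calc |δ| * |inner ℝ g t| ≤ |δ| * (‖g‖ * ‖t‖) := by
            gcongr
            exact abs_real_inner_le_norm g t
        _ ≤ 1 / 2 * ‖t‖ := by
            rw [← mul_assoc]
            gcongr
    have e3' : ‖t‖ ≤ ‖g'‖ + ‖δ • inner ℝ g t • e3‖ := by
      conv_lhs => rw [e1]
      exact norm_sub_le _ _
    linarith
  have hle : ‖g'‖ * ‖g'‖ ≤ ‖g'‖ * (2 * ‖g‖) := by
    rw [← real_inner_self_eq_norm_mul_norm, hgt]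
    refine (real_inner_le_norm g t).trans ?_
    nlinarith [norm_nonneg g]
  by_cases h0 : ‖g'‖ = 0
  · rw [h0]
    positivity
  · exact le_of_mul_le_mul_left hle (lt_of_le_of_ne (norm_nonneg _) (Ne.symm h0))

/-! ### The two gaps on a set with tangent planes everywhere -/

/-- The scalar function `u` displaces the set `G` along `e3` regularly, and `v` is `u` transported
to the displaced set, so that `ale v (-δ)` is the inverse displacement. The data are symmetric:
`v` displaces `ale u δ '' G` back to `G` over the time step `-δ`. -/
structure IsRegularPair (G : Set Space) (u v : Space → ℝ) (δ : ℝ) : Prop where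
  measurableSet : MeasurableSet G
  area_lt_top : μHE[2] G < ⊤
  tangent : ∀ x ∈ G, HasTangentPlaneAt G x
  c1 : ∀ x ∈ G, IsC1WithinAt u G x
  c1_inv : ∀ y ∈ ale u δ '' G, IsC1WithinAt v (ale u δ '' G) y
  apply_ale : ∀ x ∈ G, v (ale u δ x) = u x
  bdd : ∃ K, ∀ x ∈ G, ‖tangentialGradient G u x‖ ≤ K
  bdd_inv : ∃ K, ∀ y ∈ ale u δ '' G, ‖tangentialGradient (ale u δ '' G) v y‖ ≤ K

namespace IsRegularPair

variable {G : Set Space} {u v : Space → ℝ} {δ : ℝ}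

lemma leftInvOn (h : IsRegularPair G u v δ) : LeftInvOn (ale v (-δ)) (ale u δ) G := by
  intro x hx
  rw [ale, meshVelocity, h.apply_ale x hx, ale, meshVelocity]
  module

lemma isC1DiffeoOn (h : IsRegularPair G u v δ) : IsC1DiffeoOn G (ale u δ) (ale v (-δ)) :=
  ⟨h.leftInvOn, fun x hx => (h.c1 x hx).ale δ, fun y hy => (h.c1_inv y hy).ale (-δ)⟩

lemma image_image (h : IsRegularPair G u v δ) : ale v (-δ) '' (ale u δ '' G) = G :=
  h.isC1DiffeoOn.image_image

lemma isTangentialJacobian (h : IsRegularPair G u v δ) :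
    IsTangentialJacobian G (ale u δ) (aleJacobian G u δ) :=
  isTangentialJacobian_aleJacobian δ h.tangent h.c1

lemma continuousOn_gradient (h : IsRegularPair G u v δ) :
    ContinuousOn (tangentialGradient G u) G := continuousOn_tangentialGradient h.tangent h.c1

lemma continuousOn_jacobian (h : IsRegularPair G u v δ) : ContinuousOn (aleJacobian G u δ) G :=
  continuousOn_aleJacobian δ h.tangent h.c1

lemma jacobian_pos (h : IsRegularPair G u v δ) : ∀ x ∈ G, 0 < aleJacobian G u δ x :=
  h.isC1DiffeoOn.tangentialJacobian_pos h.isTangentialJacobian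

end IsRegularPair

lemma abs_inner_e3_le (g : Space) : |inner ℝ e3 g| ≤ ‖g‖ := by
  simpa [norm_e3] using abs_real_inner_le_norm e3 g

lemma aleJacobian_le_one_add (S : Set Space) (u : Space → ℝ) (δ : ℝ) (x : Space) :
    aleJacobian S u δ x ≤ 1 + 2 * (|δ| * ‖tangentialGradient S u x‖) := by
  set g := tangentialGradient S u x
  have h1 : |δ * inner ℝ e3 g| ≤ |δ| * ‖g‖ := by
    rw [abs_mul]
    exact mul_le_mul_of_nonneg_left (abs_inner_e3_le g) (abs_nonneg δ)
  have h3 := abs_le.mp h1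
  have h0 : 0 ≤ |δ| * ‖g‖ := by positivity
  have h4 : 0 ≤ δ ^ 2 * ‖g‖ ^ 2 := by positivity
  have h5 : δ ^ 2 * ((1 - ‖tangentProj S x e3‖ ^ 2) * ‖g‖ ^ 2) ≤ (|δ| * ‖g‖) ^ 2 := by
    rw [mul_pow, sq_abs]
    nlinarith [mul_nonneg h4 (sq_nonneg ‖tangentProj S x e3‖)]
  apply Real.sqrt_le_iff.mpr
  constructor
  · linarith
  · nlinarith

namespace IsRegularPair

variable {G : Set Space} {u v : Space → ℝ} {δ : ℝ}

lemma area_image_le (h : IsRegularPair G u v δ) {c : ℝ}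
    (hc : ∀ᵐ x ∂surfaceMeasure G, aleJacobian G u δ x ≤ c) :
    μHE[2] (ale u δ '' G) ≤ ENNReal.ofReal c * μHE[2] G := by
  have hmap := h.isC1DiffeoOn.map_withDensity h.tangent h.measurableSet h.isTangentialJacobian
    h.continuousOn_jacobian h.jacobian_pos
  have hA : AEMeasurable (ale u δ) (surfaceMeasure G) :=
    h.isC1DiffeoOn.continuousOn.aemeasurable h.measurableSet
  have h1 := hmap ▸ Measure.map_apply_of_aemeasurable
    (hA.mono_ac (withDensity_absolutelyContinuous _ _)) MeasurableSet.univ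
  rw [preimage_univ, withDensity_apply _ MeasurableSet.univ, Measure.restrict_univ, surfaceMeasure,
    Measure.restrict_apply_univ] at h1
  rw [h1, ← setLIntegral_const]
  refine lintegral_mono_ae ?_
  filter_upwards [hc] with x hx
  exact ENNReal.ofReal_le_ofReal hx

lemma symm (h : IsRegularPair G u v δ) : IsRegularPair (ale u δ '' G) v u (-δ) where
  measurableSet := h.isC1DiffeoOn.measurableSet_image h.measurableSet
  area_lt_top := by
    obtain ⟨K, hK⟩ := h.bdd
    refine (h.area_image_le (c := 1 + 2 * (|δ| * K)) ?_).trans_lt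
      (ENNReal.mul_lt_top ENNReal.ofReal_lt_top h.area_lt_top)
    filter_upwards [ae_restrict_mem h.measurableSet] with x hx
    refine (aleJacobian_le_one_add G u δ x).trans ?_
    gcongr
    exact hK x hx
  tangent := h.isC1DiffeoOn.hasTangentPlaneAt_image h.tangent
  c1 := h.c1_inv
  c1_inv := by
    rw [h.image_image]
    exact h.c1
  apply_ale := by
    rintro _ ⟨x, hx, rfl⟩
    rw [h.leftInvOn hx, h.apply_ale x hx]
  bdd := h.bdd_inv
  bdd_inv := by
    rw [h.image_image]
    exact h.bdd

/-- The Jacobian of the inverse displacement is bounded, so composition with the displacement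
preserves integrability. -/
lemma integrable_comp (h : IsRegularPair G u v δ) {φ : Space → ℝ}
    (hφ : Integrable φ (surfaceMeasure (ale u δ '' G))) :
    Integrable (fun y => φ (ale u δ y)) (surfaceMeasure G) := by
  have h1 := (h.isC1DiffeoOn.integral_image h.tangent h.measurableSet h.isTangentialJacobian
    h.continuousOn_jacobian h.jacobian_pos hφ.aestronglyMeasurable).1
  have hs := h.symm
  have h2 := hs.isC1DiffeoOn.integral_image hs.tangent hs.measurableSet hs.isTangentialJacobian
    hs.continuousOn_jacobian hs.jacobian_pos (φ := fun y => φ (ale u δ y))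
  rw [h.image_image] at h2
  refine (h2 h1).2.1.mpr ?_
  obtain ⟨K, hK⟩ := hs.bdd
  have hbdd : Integrable (fun x => aleJacobian (ale u δ '' G) v (-δ) x * φ x)
      (surfaceMeasure (ale u δ '' G)) := by
    refine hφ.bdd_mul (c := 1 + 2 * (|-δ| * K))
      (hs.continuousOn_jacobian.aestronglyMeasurable hs.measurableSet) ?_
    filter_upwards [ae_restrict_mem hs.measurableSet] with x hx
    rw [Real.norm_of_nonneg (hs.jacobian_pos x hx).le]
    refine (aleJacobian_le_one_add _ _ _ _).trans ?_
    gcongr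
    exact hK x hx
  refine hbdd.congr ?_
  filter_upwards [ae_restrict_mem hs.measurableSet] with x hx
  obtain ⟨y, hy, rfl⟩ := hx
  rw [h.leftInvOn hy]

lemma integrable_mul_inner (h : IsRegularPair G u v δ) {ψ : Space → ℝ}
    (hψ : Integrable ψ (surfaceMeasure G)) :
    Integrable (fun y => ψ y * inner ℝ e3 (tangentialGradient G u y)) (surfaceMeasure G) := by
  obtain ⟨K, hK⟩ := h.bdd
  have hm : ContinuousOn (fun y => inner ℝ e3 (tangentialGradient G u y)) G :=
    continuousOn_const.inner (𝕜 := ℝ) h.continuousOn_gradient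
  refine hψ.mul_bdd (c := K) (hm.aestronglyMeasurable h.measurableSet) ?_
  filter_upwards [ae_restrict_mem h.measurableSet] with x hx
  exact (abs_inner_e3_le _).trans (hK x hx)

/-- The gap in the first inequality is the integral of the excess of the Jacobian over its
linearization. -/
lemma gap_eq (h : IsRegularPair G u v δ) {φ : Space → ℝ}
    (hφ : Integrable φ (surfaceMeasure (ale u δ '' G))) :
    increment G u δ φ - δ * ∫ y, φ (ale u δ y) * inner ℝ e3 (tangentialGradient G u y)
        ∂surfaceMeasure G =
      ∫ y, φ (ale u δ y) * (aleJacobian G u δ y -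
        (1 + δ * inner ℝ e3 (tangentialGradient G u y))) ∂surfaceMeasure G := by
  obtain ⟨-, h2, h3⟩ := h.isC1DiffeoOn.integral_image h.tangent h.measurableSet
    h.isTangentialJacobian h.continuousOn_jacobian h.jacobian_pos hφ.aestronglyMeasurable
  have i1 := h.integrable_comp hφ
  have i2 := h.integrable_mul_inner i1
  have i3 := h2.mp hφ
  have i4 : Integrable (fun y => aleJacobian G u δ y * φ (ale u δ y) - φ (ale u δ y))
      (surfaceMeasure G) := i3.sub i1
  rw [increment, h3, ← integral_const_mul, ← integral_sub i3 i1,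
    ← integral_sub i4 (i2.const_mul δ)]
  refine integral_congr_ae (Eventually.of_forall fun y => ?_)
  ring

lemma gap_nonneg (h : IsRegularPair G u v δ) {φ : Space → ℝ}
    (hφ : Integrable φ (surfaceMeasure (ale u δ '' G))) (h0 : ∀ x ∈ ale u δ '' G, 0 ≤ φ x) :
    0 ≤ increment G u δ φ - δ * ∫ y, φ (ale u δ y) * inner ℝ e3 (tangentialGradient G u y)
        ∂surfaceMeasure G := by
  rw [h.gap_eq hφ]
  refine integral_nonneg_of_ae ?_
  filter_upwards [ae_restrict_mem h.measurableSet] with y hy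
  exact mul_nonneg (h0 _ (mem_image_of_mem _ hy))
    (sub_nonneg.mpr (one_add_le_aleJacobian G u δ y))

lemma abs_gap_le (h : IsRegularPair G u v δ) {φ : Space → ℝ} {M L : ℝ}
    (hφ : Integrable φ (surfaceMeasure (ale u δ '' G))) (hM0 : 0 ≤ M)
    (hM : ∀ x ∈ ale u δ '' G, |φ x| ≤ M)
    (hL : ∀ᵐ y ∂surfaceMeasure G, ‖tangentialGradient G u y‖ ≤ L) (hδ : |δ| * L ≤ 1 / 2) :
    |increment G u δ φ - δ * ∫ y, φ (ale u δ y) * inner ℝ e3 (tangentialGradient G u y)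
        ∂surfaceMeasure G| ≤ M * (δ ^ 2 * L ^ 2) * (μHE[2] G).toReal := by
  rw [h.gap_eq hφ, ← Real.norm_eq_abs]
  refine norm_setIntegral_le_of_norm_le_const_ae h.area_lt_top ?_
  filter_upwards [ae_restrict_mem h.measurableSet, hL] with y hy hLy
  have h1 := one_add_le_aleJacobian G u δ y
  have h2 := aleJacobian_le (S := G) (u := u) (δ := δ) (x := y)
    ((mul_le_mul_of_nonneg_left hLy (abs_nonneg δ)).trans hδ)
  have h3 : δ ^ 2 * ‖tangentialGradient G u y‖ ^ 2 ≤ δ ^ 2 * L ^ 2 := by gcongr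
  rw [norm_mul, Real.norm_eq_abs, Real.norm_eq_abs]
  refine mul_le_mul (hM _ (mem_image_of_mem _ hy)) ?_ (abs_nonneg _) hM0
  rw [abs_of_nonneg (by linarith)]
  linarith

/-- The gap in the second inequality is, up to its sign, the first gap of the inverse
displacement. -/
lemma gap_symm (h : IsRegularPair G u v δ) (φ : Space → ℝ) :
    increment (ale u δ '' G) v (-δ) (fun y => φ (ale u δ y)) -
        -δ * ∫ x, φ (ale u δ (ale v (-δ) x)) *
          inner ℝ e3 (tangentialGradient (ale u δ '' G) v x) ∂surfaceMeasure (ale u δ '' G) =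
      -(increment G u δ φ - δ * ∫ x, φ x *
        inner ℝ e3 (tangentialGradient (ale u δ '' G) v x) ∂surfaceMeasure (ale u δ '' G)) := by
  have hm := h.symm.measurableSet
  have e1 : ∫ x, φ (ale u δ (ale v (-δ) x)) ∂surfaceMeasure (ale u δ '' G) =
      ∫ x, φ x ∂surfaceMeasure (ale u δ '' G) := by
    refine setIntegral_congr_fun hm fun x hx => ?_
    simp only [h.isC1DiffeoOn.symm.leftInvOn hx]
  have e2 : ∫ x, φ (ale u δ (ale v (-δ) x)) *
      inner ℝ e3 (tangentialGradient (ale u δ '' G) v x) ∂surfaceMeasure (ale u δ '' G) =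
      ∫ x, φ x * inner ℝ e3 (tangentialGradient (ale u δ '' G) v x)
        ∂surfaceMeasure (ale u δ '' G) := by
    refine setIntegral_congr_fun hm fun x hx => ?_
    simp only [h.isC1DiffeoOn.symm.leftInvOn hx]
  rw [e2, increment, increment, h.image_image, e1]
  ring

lemma integrable_comp_comp (h : IsRegularPair G u v δ) {φ : Space → ℝ}
    (hφ : Integrable φ (surfaceMeasure (ale u δ '' G))) :
    Integrable (fun y => φ (ale u δ y)) (surfaceMeasure (ale v (-δ) '' (ale u δ '' G))) := by
  rw [h.image_image]
  exact h.integrable_comp hφ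

lemma gap_inv_nonpos (h : IsRegularPair G u v δ) {φ : Space → ℝ}
    (hφ : Integrable φ (surfaceMeasure (ale u δ '' G))) (h0 : ∀ x ∈ ale u δ '' G, 0 ≤ φ x) :
    increment G u δ φ - δ * ∫ x, φ x *
        inner ℝ e3 (tangentialGradient (ale u δ '' G) v x) ∂surfaceMeasure (ale u δ '' G) ≤ 0 := by
  have := h.symm.gap_nonneg (h.integrable_comp_comp hφ) (by
    rw [h.image_image]
    exact fun x hx => h0 _ (mem_image_of_mem _ hx))
  rw [h.gap_symm] at this
  linarith

end IsRegularPair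

/-- Maps that are `C¹` along a set of zero area map it to a set of zero area. -/
lemma area_image_eq_zero {N : Set Space} {A : Space → Space} (hA : ∀ x ∈ N, IsC1WithinAt A N x)
    (hN : μHE[2] N = 0) : μHE[2] (A '' N) = 0 := by
  have hloc : ∀ x ∈ N, ∃ U ∈ 𝓝[N] x, μHE[2] (A '' (U ∩ N)) = 0 := by
    intro x hx
    obtain ⟨a, ha, hAa⟩ := hA x hx
    obtain ⟨K, s, hs, hlip⟩ := ha.exists_lipschitzOnWith
    refine ⟨_, inter_mem (mem_nhdsWithin_of_mem_nhds hs) hAa, le_antisymm ?_ zero_le⟩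
    refine (area_image_le_of_norm_sub_le (p := id) (K := K) K.2 ?_).trans ?_
    · rintro y ⟨⟨hys, hya⟩, -⟩ z ⟨⟨hzs, hza⟩, -⟩
      rw [show A y = a y from hya, show A z = a z from hza, ← dist_eq_norm, ← dist_eq_norm]
      exact hlip.dist_le_mul y hys z hzs
    · rw [image_id, measure_mono_null inter_subset_right hN, mul_zero]
  choose! U hU hU0 using hloc
  obtain ⟨t, htN, htc, hcov⟩ := TopologicalSpace.countable_cover_nhdsWithin hU
  have hsub : A '' N ⊆ ⋃ x ∈ t, A '' (U x ∩ N) := by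
    rintro _ ⟨y, hy, rfl⟩
    obtain ⟨x, hxt, hyx⟩ := mem_iUnion₂.mp (hcov hy)
    exact mem_iUnion₂.mpr ⟨x, hxt, mem_image_of_mem A ⟨hyx, hy⟩⟩
  refine measure_mono_null hsub ((measure_biUnion_null_iff htc).mpr fun x hx => hU0 x (htN hx))

lemma IsRegularPair.ae_norm_tangentialGradient_image_le {G : Set Space} {u v : Space → ℝ} {δ : ℝ}
    (h : IsRegularPair G u v δ) {L : ℝ}
    (hL : ∀ᵐ y ∂surfaceMeasure G, ‖tangentialGradient G u y‖ ≤ L) (hδ : |δ| * L ≤ 1 / 2) :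
    ∀ᵐ x ∂surfaceMeasure (ale u δ '' G), ‖tangentialGradient (ale u δ '' G) v x‖ ≤ 2 * L := by
  set N : Set Space := {y | y ∈ G ∧ ¬ ‖tangentialGradient G u y‖ ≤ L}
  have hN : μHE[2] N = 0 := by
    have := (ae_restrict_iff' h.measurableSet).mp hL
    rw [ae_iff] at this
    simpa only [Classical.not_imp] using this
  have hAN : μHE[2] (ale u δ '' N) = 0 := by
    refine area_image_eq_zero (fun x hx => ?_) hN
    obtain ⟨a, ha, hAa⟩ := (h.c1 x hx.1).ale δ
    exact ⟨a, ha, hAa.filter_mono (nhdsWithin_mono x fun y hy => hy.1)⟩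
  refine (ae_restrict_iff' h.symm.measurableSet).mpr (measure_mono_null ?_ hAN)
  intro y hy
  simp only [mem_compl_iff, mem_ofPred_eq, Classical.not_imp] at hy
  obtain ⟨⟨x, hx, rfl⟩, hxL⟩ := hy
  refine mem_image_of_mem _ ⟨hx, fun hle => hxL ?_⟩
  refine (norm_tangentialGradient_image_le h.isC1DiffeoOn hx (h.c1 x hx)
    (h.c1_inv _ (mem_image_of_mem _ hx)) h.apply_ale
    ((mul_le_mul_of_nonneg_left hle (abs_nonneg δ)).trans hδ)).trans ?_
  linarith

lemma IsRegularPair.abs_gap_inv_le {G : Set Space} {u v : Space → ℝ} {δ : ℝ}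
    (h : IsRegularPair G u v δ) {φ : Space → ℝ} {M L : ℝ}
    (hφ : Integrable φ (surfaceMeasure (ale u δ '' G))) (hM0 : 0 ≤ M)
    (hM : ∀ x ∈ ale u δ '' G, |φ x| ≤ M)
    (hL : ∀ᵐ y ∂surfaceMeasure G, ‖tangentialGradient G u y‖ ≤ L) (hδ : |δ| * L ≤ 1 / 4) :
    |increment G u δ φ - δ * ∫ x, φ x * inner ℝ e3 (tangentialGradient (ale u δ '' G) v x)
        ∂surfaceMeasure (ale u δ '' G)| ≤
      M * (δ ^ 2 * (2 * L) ^ 2) * (2 * (μHE[2] G).toReal) := by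
  have h1 := h.symm.abs_gap_le (M := M) (h.integrable_comp_comp hφ) hM0 (by
    rw [h.image_image]
    exact fun x hx => hM _ (mem_image_of_mem _ hx))
    (h.ae_norm_tangentialGradient_image_le hL (by linarith)) (by rw [abs_neg]; linarith)
  rw [h.gap_symm, abs_neg, neg_sq] at h1
  refine h1.trans (mul_le_mul_of_nonneg_left ?_ (by positivity))
  have h2 := h.area_image_le (c := 2) (by
    filter_upwards [hL] with y hy
    have h3 := aleJacobian_le_one_add G u δ y
    have h4 := mul_le_mul_of_nonneg_left hy (abs_nonneg δ)
    linarith)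
  have h5 := ENNReal.toReal_mono (ENNReal.mul_ne_top ENNReal.ofReal_ne_top h.area_lt_top.ne) h2
  rwa [ENNReal.toReal_mul, ENNReal.toReal_ofReal zero_le_two] at h5

/-! ### The regular part of a piecewise `C¹` surface -/

variable {ι : Type*}

/-- The points that lie in exactly one of the faces `F i`. -/
def regularPart (F : ι → Set Space) : Set Space := {x | ∃! i, x ∈ F i}

lemma surfaceGradient_congr {S S' : Set Space} {x : Space} (h : S =ᶠ[𝓝 x] S')
    (X : Space → Space) : surfaceGradient S X x = surfaceGradient S' X x := by
  simp only [surfaceGradient, tangentProj,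
    tangentSpace_congr (nhdsWithin_eq_iff_eventuallyEq.mpr h), fderivWithin_congr_set h]

lemma regularPart_subset_iUnion (F : ι → Set Space) : regularPart F ⊆ ⋃ i, F i :=
  fun _ ⟨i, hi, _⟩ => mem_iUnion.mpr ⟨i, hi⟩

lemma iUnion_diff_regularPart (F : ι → Set Space) :
    (⋃ i, F i) \ regularPart F ⊆ ⋃ i, ⋃ j, ⋃ _ : i ≠ j, F i ∩ F j := by
  rintro x ⟨hx, hxG⟩
  obtain ⟨i, hi⟩ := mem_iUnion.mp hx
  by_contra hcon
  refine hxG ⟨i, hi, fun j hj => ?_⟩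
  by_contra hij
  exact hcon (mem_iUnion.mpr ⟨i, mem_iUnion.mpr ⟨j, mem_iUnion.mpr ⟨fun h => hij h.symm, hi, hj⟩⟩⟩)

lemma regularPart_image {F : ι → Set Space} {A : Space → Space} (hA : InjOn A (⋃ i, F i)) :
    regularPart (fun i => A '' F i) = A '' regularPart F := by
  have hiff : ∀ x ∈ ⋃ i, F i, ∀ j, A x ∈ A '' F j ↔ x ∈ F j := by
    intro x hx j
    refine ⟨?_, mem_image_of_mem A⟩
    rintro ⟨z, hz, hzx⟩
    exact hA (mem_iUnion.mpr ⟨j, hz⟩) hx hzx ▸ hz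
  ext y
  constructor
  · rintro ⟨i, ⟨x, hx, rfl⟩, huniq⟩
    have hxS : x ∈ ⋃ i, F i := mem_iUnion.mpr ⟨i, hx⟩
    exact mem_image_of_mem A ⟨i, hx, fun j hj => huniq j (mem_image_of_mem A hj)⟩
  · rintro ⟨x, ⟨i, hx, huniq⟩, rfl⟩
    have hxS : x ∈ ⋃ i, F i := mem_iUnion.mpr ⟨i, hx⟩
    exact ⟨i, mem_image_of_mem A hx, fun j hj => huniq j ((hiff x hxS j).mp hj)⟩

lemma IsPiecewiseC1On.isC1WithinAt_face {F : ι → Set Space} {w : Space → ℝ}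
    (hw : IsPiecewiseC1On F w) (i : ι) {N : Set Space} (hN : N ⊆ F i) (x : Space) :
    IsC1WithinAt w N x := by
  obtain ⟨U, hU, hwU⟩ := hw i
  exact ⟨U, hU.contDiffAt, eventually_nhdsWithin_of_forall fun y hy => hwU (hN hy)⟩

lemma IsPiecewiseC1Surface.area_inter {F : ι → Set Space} (hF : IsPiecewiseC1Surface F) {i j : ι}
    (hij : i ≠ j) : μHE[2] (F i ∩ F j) = 0 := by
  have : surfaceMeasure (F i) (F j) = 0 := hF.2 hij
  rwa [surfaceMeasure, Measure.restrict_apply ((hF.1 j).1.isClosed.measurableSet),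
    inter_comm] at this

lemma IsRegularDisplacement.isCompact_image {F : ι → Set Space} (hF : IsPiecewiseC1Surface F)
    {w : Space → ℝ} {δ : ℝ} (h : IsRegularDisplacement F w δ) (i : ι) :
    IsCompact (ale w δ '' F i) :=
  (hF.1 i).1.image_of_continuousOn fun x hx =>
    ((h.1.isC1WithinAt_face i Subset.rfl x).ale δ).continuousWithinAt hx

variable [Finite ι]

/-- Near a point that lies in a single face, the surface, its regular part and the face coincide. -/
lemma eventuallyEq_face {F : ι → Set Space} (hF : ∀ i, IsClosed (F i)) {x : Space} {i : ι}
    (hx : ∀ j, x ∈ F j → j = i) :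
    (⋃ i, F i : Set Space) =ᶠ[𝓝 x] F i ∧ regularPart F =ᶠ[𝓝 x] F i := by
  have h : ∀ᶠ y in 𝓝 x, ∀ j, j ≠ i → y ∉ F j := by
    refine eventually_all.mpr fun j => ?_
    by_cases hj : j = i
    · exact Eventually.of_forall fun y hy => absurd hj hy
    · filter_upwards [(hF j).isOpen_compl.mem_nhds fun hxj => hj (hx j hxj)] with y hy _ using hy
  constructor
  · filter_upwards [h] with y hy
    refine propext ⟨fun hyS => ?_, fun hyi => mem_iUnion.mpr ⟨i, hyi⟩⟩
    obtain ⟨j, hj⟩ := mem_iUnion.mp hyS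
    by_cases hji : j = i
    · exact hji ▸ hj
    · exact absurd hj (hy j hji)
  · filter_upwards [h] with y hy
    refine propext ⟨?_, fun hyi => ⟨i, hyi, fun j hj => by_contra fun hji => hy j hji hj⟩⟩
    rintro ⟨j, hj, -⟩
    by_cases hji : j = i
    · exact hji ▸ hj
    · exact absurd hj (hy j hji)

lemma measurableSet_regularPart {F : ι → Set Space} (hF : ∀ i, IsClosed (F i)) :
    MeasurableSet (regularPart F) := by
  have h : regularPart F = ⋃ i, (F i \ ⋃ j, ⋃ _ : j ≠ i, F j) := by
    ext x
    simp only [regularPart, ExistsUnique, mem_iUnion, Set.mem_sdiff, mem_ofPred_eq, not_exists]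
    refine exists_congr fun i => and_congr_right fun _ => forall_congr' fun j => ?_
    tauto
  rw [h]
  refine MeasurableSet.iUnion fun i => (hF i).measurableSet.diff ?_
  exact MeasurableSet.iUnion fun j => MeasurableSet.iUnion fun _ => (hF j).measurableSet

lemma IsPiecewiseC1On.isC1WithinAt {F : ι → Set Space} (hF : ∀ i, IsClosed (F i))
    {w : Space → ℝ} (hw : IsPiecewiseC1On F w) :
    ∀ x ∈ regularPart F, IsC1WithinAt w (regularPart F) x := by
  rintro x ⟨i, hi, hx⟩
  obtain ⟨U, hU, hwU⟩ := hw i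
  refine ⟨U, hU.contDiffAt, ?_⟩
  rw [nhdsWithin_eq_iff_eventuallyEq.mpr (eventuallyEq_face hF hx).2]
  exact eventually_nhdsWithin_of_forall hwU

lemma IsPiecewiseC1On.exists_norm_tangentialGradient_le {F : ι → Set Space}
    (hF : ∀ i, IsCompact (F i)) {w : Space → ℝ} (hw : IsPiecewiseC1On F w) :
    ∃ K, ∀ x ∈ regularPart F, ‖tangentialGradient (regularPart F) w x‖ ≤ K := by
  choose U hU hwU using hw
  have hK : ∀ i, ∃ K, ∀ x ∈ F i, ‖fderiv ℝ (U i) x‖ ≤ K := fun i =>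
    (hF i).exists_bound_of_continuousOn ((hU i).continuous_fderiv one_ne_zero).continuousOn
  choose K hK using hK
  obtain ⟨K', hK'⟩ := Finite.bddAbove_range K
  refine ⟨K', fun x hx => ?_⟩
  obtain ⟨i, hi, hxi⟩ := id hx
  refine (norm_tangentialGradient_le hx (hU i).contDiffAt ?_).trans
    ((hK i x hi).trans (hK' (mem_range_self i)))
  rw [nhdsWithin_eq_iff_eventuallyEq.mpr (eventuallyEq_face (fun i => (hF i).isClosed) hxi).2]
  exact eventually_nhdsWithin_of_forall (hwU i)

lemma IsPiecewiseC1Surface.surfaceMeasure_regularPart {F : ι → Set Space}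
    (hF : IsPiecewiseC1Surface F) :
    surfaceMeasure (⋃ i, F i) = surfaceMeasure (regularPart F) := by
  refine Measure.restrict_congr_set (ae_eq_set.mpr ⟨?_, ?_⟩)
  · refine measure_mono_null (iUnion_diff_regularPart F) ?_
    simp only [measure_iUnion_null_iff]
    exact fun i j hij => hF.area_inter hij
  · rw [sdiff_eq_empty.mpr (regularPart_subset_iUnion F), measure_empty]

lemma surfaceMeasure_image_regularPart {F : ι → Set Space} (hF : IsPiecewiseC1Surface F)
    {w : Space → ℝ} (hw : IsPiecewiseC1On F w) (δ : ℝ) :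
    surfaceMeasure (ale w δ '' ⋃ i, F i) = surfaceMeasure (ale w δ '' regularPart F) := by
  refine Measure.restrict_congr_set (ae_eq_set.mpr ⟨?_, ?_⟩)
  · have hsub : (ale w δ '' ⋃ i, F i) \ (ale w δ '' regularPart F) ⊆
        ale w δ '' ⋃ i, ⋃ j, ⋃ _ : i ≠ j, F i ∩ F j := by
      rintro _ ⟨⟨x, hx, rfl⟩, hn⟩
      exact mem_image_of_mem _ (iUnion_diff_regularPart F ⟨hx, fun h => hn (mem_image_of_mem _ h)⟩)
    refine measure_mono_null hsub ?_
    simp only [image_iUnion, measure_iUnion_null_iff]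
    exact fun i j hij => area_image_eq_zero
      (fun x _ => (hw.isC1WithinAt_face i inter_subset_left x).ale δ) (hF.area_inter hij)
  · rw [sdiff_eq_empty.mpr (image_mono (regularPart_subset_iUnion F)), measure_empty]

lemma IsRegularDisplacement.isRegularPair {F : ι → Set Space} (hF : IsPiecewiseC1Surface F)
    {w : Space → ℝ} {δ : ℝ} (h : IsRegularDisplacement F w δ) :
    IsRegularPair (regularPart F) w (w ∘ aleInv (⋃ i, F i) w δ) δ := by
  have hcl : ∀ i, IsClosed (F i) := fun i => (hF.1 i).1.isClosed
  have himg := regularPart_image h.2.1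
  refine ⟨measurableSet_regularPart hcl, ?_, ?_, h.1.isC1WithinAt hcl, ?_, ?_,
    h.1.exists_norm_tangentialGradient_le fun i => (hF.1 i).1, ?_⟩
  · refine (measure_mono (regularPart_subset_iUnion F)).trans_lt ?_
    have := Fintype.ofFinite ι
    refine (measure_iUnion_fintype_le _ _).trans_lt (ENNReal.sum_lt_top.mpr fun i _ => ?_)
    exact area_lt_top_of_isCompact (hF.1 i).1 (hF.1 i).hasTangentPlaneAt
  · rintro x ⟨i, hi, hx⟩
    exact ((hF.1 i).hasTangentPlaneAt x hi).congr (eventuallyEq_face hcl hx).2.symm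
  · rw [← himg]
    exact h.2.2.isC1WithinAt fun i => (h.isCompact_image hF i).isClosed
  · intro x hx
    rw [Function.comp_apply, aleInv, h.2.1.leftInvOn_invFunOn (regularPart_subset_iUnion F hx)]
  · rw [← himg]
    exact h.2.2.exists_norm_tangentialGradient_le fun i => h.isCompact_image hF i

/-- At regular points the surface gradient of the whole surface is that of the regular part. -/
lemma IsRegularDisplacement.divOld_eq {F : ι → Set Space} (hF : IsPiecewiseC1Surface F)
    {w : Space → ℝ} {δ : ℝ} (h : IsRegularDisplacement F w δ) {x : Space}
    (hx : x ∈ regularPart F) :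
    ‖surfaceGradient (⋃ i, F i) (meshVelocity w) x‖ = ‖tangentialGradient (regularPart F) w x‖ ∧
    divOld (⋃ i, F i) w x = inner ℝ e3 (tangentialGradient (regularPart F) w x) := by
  obtain ⟨i, hi, hxi⟩ := id hx
  have hcl : ∀ i, IsClosed (F i) := fun i => (hF.1 i).1.isClosed
  have hgerm := eventuallyEq_face hcl hxi
  have hu := h.1.isC1WithinAt hcl x hx
  rw [divOld, ← norm_surfaceGradient hx hu, ← surfaceDiv_eq_inner hx hu, surfaceDiv, surfaceDiv,
    surfaceGradient_congr (hgerm.1.trans hgerm.2.symm)]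
  exact ⟨rfl, rfl⟩

lemma IsRegularDisplacement.divNew_eq {F : ι → Set Space} (hF : IsPiecewiseC1Surface F)
    {w : Space → ℝ} {δ : ℝ} (h : IsRegularDisplacement F w δ) {y : Space}
    (hy : y ∈ ale w δ '' regularPart F) :
    divNew (⋃ i, F i) w δ y = inner ℝ e3 (tangentialGradient (ale w δ '' regularPart F)
      (w ∘ aleInv (⋃ i, F i) w δ) y) := by
  have hcl : ∀ i, IsClosed (ale w δ '' F i) := fun i => (h.isCompact_image hF i).isClosed
  have himg := regularPart_image h.2.1
  rw [← himg] at hy ⊢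
  obtain ⟨i, hi, hyi⟩ := id hy
  have hgerm := eventuallyEq_face (F := fun i => ale w δ '' F i) hcl hyi
  rw [← surfaceDiv_eq_inner hy (h.2.2.isC1WithinAt hcl y hy), divNew, image_iUnion, surfaceDiv,
    surfaceDiv, surfaceGradient_congr (hgerm.1.trans hgerm.2.symm)]
  rfl

lemma IsRegularDisplacement.increment_eq {F : ι → Set Space} (hF : IsPiecewiseC1Surface F)
    {w : Space → ℝ} {δ : ℝ} (h : IsRegularDisplacement F w δ) (φ : Space → ℝ) :
    increment (⋃ i, F i) w δ φ = increment (regularPart F) w δ φ := by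
  rw [increment, increment, hF.surfaceMeasure_regularPart, surfaceMeasure_image_regularPart hF h.1]

lemma IsRegularDisplacement.mul_divOld_ae_eq {F : ι → Set Space} (hF : IsPiecewiseC1Surface F)
    {w : Space → ℝ} {δ : ℝ} (h : IsRegularDisplacement F w δ) (φ : Space → ℝ) :
    (fun y => φ (ale w δ y) * divOld (⋃ i, F i) w y) =ᵐ[surfaceMeasure (regularPart F)]
      fun y => φ (ale w δ y) * inner ℝ e3 (tangentialGradient (regularPart F) w y) := by
  filter_upwards [ae_restrict_mem (h.isRegularPair hF).measurableSet] with y hy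
  rw [(h.divOld_eq hF hy).2]

lemma IsRegularDisplacement.mul_divNew_ae_eq {F : ι → Set Space} (hF : IsPiecewiseC1Surface F)
    {w : Space → ℝ} {δ : ℝ} (h : IsRegularDisplacement F w δ) (φ : Space → ℝ) :
    (fun x => φ x * divNew (⋃ i, F i) w δ x) =ᵐ[surfaceMeasure (ale w δ '' regularPart F)]
      fun x => φ x * inner ℝ e3 (tangentialGradient (ale w δ '' regularPart F)
        (w ∘ aleInv (⋃ i, F i) w δ) x) := by
  filter_upwards [ae_restrict_mem (h.isRegularPair hF).symm.measurableSet] with x hx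
  rw [h.divNew_eq hF hx]

end SurfaceGCL

end

theorem mainTheorem1 {ι : Type*} [Finite ι] (F : ι → Set SurfaceGCL.Space)
    (S : Set SurfaceGCL.Space) (hS : S = ⋃ i, F i)
    (hF : SurfaceGCL.IsPiecewiseC1Surface F) :
    -- the two inequalities, together with the integrability of all the integrands
    (∀ (w : SurfaceGCL.Space → ℝ) (δt : ℝ), 0 < δt → SurfaceGCL.IsRegularDisplacement F w δt →
      ∀ φ : SurfaceGCL.Space → ℝ,
        Integrable φ (SurfaceGCL.surfaceMeasure (SurfaceGCL.ale w δt '' S)) →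
        Integrable (fun y => φ (SurfaceGCL.ale w δt y)) (SurfaceGCL.surfaceMeasure S) ∧
        Integrable (fun y => φ (SurfaceGCL.ale w δt y) * SurfaceGCL.divOld S w y)
          (SurfaceGCL.surfaceMeasure S) ∧
        Integrable (fun x => φ x * SurfaceGCL.divNew S w δt x)
          (SurfaceGCL.surfaceMeasure (SurfaceGCL.ale w δt '' S)) ∧
        ((∀ x ∈ SurfaceGCL.ale w δt '' S, 0 ≤ φ x) →
          ((∀ᵐ y ∂SurfaceGCL.surfaceMeasure S, 0 ≤ 1 + δt * SurfaceGCL.divOld S w y) →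
            δt * ∫ y, φ (SurfaceGCL.ale w δt y) * SurfaceGCL.divOld S w y
                ∂SurfaceGCL.surfaceMeasure S
              ≤ SurfaceGCL.increment S w δt φ) ∧
          ((∀ᵐ x ∂SurfaceGCL.surfaceMeasure (SurfaceGCL.ale w δt '' S),
              0 ≤ 1 - δt * SurfaceGCL.divNew S w δt x) →
            SurfaceGCL.increment S w δt φ
              ≤ δt * ∫ x, φ x * SurfaceGCL.divNew S w δt x
                ∂SurfaceGCL.surfaceMeasure (SurfaceGCL.ale w δt '' S)))) ∧
    -- both gaps are of order `δt ^ 2` as `δt → 0`, uniformly over the velocities with surface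
    -- gradient bounded by `L`
    (∀ L : ℝ, ∃ C δ₀ : ℝ, 0 < δ₀ ∧
      ∀ (w : SurfaceGCL.Space → ℝ) (δt : ℝ), 0 < δt → δt ≤ δ₀ →
        SurfaceGCL.IsRegularDisplacement F w δt →
        (∀ᵐ y ∂SurfaceGCL.surfaceMeasure S,
          ‖SurfaceGCL.surfaceGradient S (SurfaceGCL.meshVelocity w) y‖ ≤ L) →
        ∀ (φ : SurfaceGCL.Space → ℝ) (M : ℝ), 0 ≤ M →
          Integrable φ (SurfaceGCL.surfaceMeasure (SurfaceGCL.ale w δt '' S)) →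
          (∀ x ∈ SurfaceGCL.ale w δt '' S, |φ x| ≤ M) →
          |SurfaceGCL.increment S w δt φ
              - δt * ∫ y, φ (SurfaceGCL.ale w δt y) * SurfaceGCL.divOld S w y
                ∂SurfaceGCL.surfaceMeasure S| ≤ C * M * δt ^ 2 ∧
          |SurfaceGCL.increment S w δt φ
              - δt * ∫ x, φ x * SurfaceGCL.divNew S w δt x
                ∂SurfaceGCL.surfaceMeasure (SurfaceGCL.ale w δt '' S)| ≤ C * M * δt ^ 2) := by
  subst hS
  have hsub {w : SurfaceGCL.Space → ℝ} {δt : ℝ} :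
      SurfaceGCL.ale w δt '' SurfaceGCL.regularPart F ⊆ SurfaceGCL.ale w δt '' ⋃ i, F i :=
    image_mono (SurfaceGCL.regularPart_subset_iUnion F)
  constructor
  · intro w δt _ h φ hφ
    have hP := h.isRegularPair hF
    rw [SurfaceGCL.surfaceMeasure_image_regularPart hF h.1] at hφ ⊢
    rw [hF.surfaceMeasure_regularPart, h.increment_eq hF,
      integral_congr_ae (h.mul_divOld_ae_eq hF φ), integral_congr_ae (h.mul_divNew_ae_eq hF φ)]
    refine ⟨hP.integrable_comp hφ, ?_, ?_, fun h0 => ⟨fun _ => ?_, fun _ => ?_⟩⟩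
    · exact (hP.integrable_mul_inner (hP.integrable_comp hφ)).congr
        (h.mul_divOld_ae_eq hF φ).symm
    · exact (hP.symm.integrable_mul_inner hφ).congr (h.mul_divNew_ae_eq hF φ).symm
    · exact sub_nonneg.mp (hP.gap_nonneg hφ fun x hx => h0 x (hsub hx))
    · exact sub_nonpos.mp (hP.gap_inv_nonpos hφ fun x hx => h0 x (hsub hx))
  · intro L
    -- for `δt ≤ 1 / (4 (|L| + 1))` the displaced surface has at most twice the area and gradients
    -- bounded by `2 |L|`, whence the factor `8 = 2 * 2 ^ 2` for the second gap
    refine ⟨8 * |L| ^ 2 * (μHE[2] (SurfaceGCL.regularPart F)).toReal, 1 / (4 * (|L| + 1)),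
      by positivity, ?_⟩
    intro w δt hδ0 hδ h hL φ M hM0 hφ hM
    have hP := h.isRegularPair hF
    rw [SurfaceGCL.surfaceMeasure_image_regularPart hF h.1] at hφ ⊢
    rw [hF.surfaceMeasure_regularPart] at hL ⊢
    rw [h.increment_eq hF, integral_congr_ae (h.mul_divOld_ae_eq hF φ),
      integral_congr_ae (h.mul_divNew_ae_eq hF φ)]
    have hL' : ∀ᵐ y ∂SurfaceGCL.surfaceMeasure (SurfaceGCL.regularPart F),
        ‖SurfaceGCL.tangentialGradient (SurfaceGCL.regularPart F) w y‖ ≤ |L| := by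
      filter_upwards [hL, ae_restrict_mem hP.measurableSet] with y hy hyG
      rw [← (h.divOld_eq hF hyG).1]
      exact hy.trans (le_abs_self L)
    have hδL : |δt| * |L| ≤ 1 / 4 := by
      rw [abs_of_pos hδ0]
      rw [le_div_iff₀ (by positivity)] at hδ
      linarith
    have hM' : ∀ x ∈ SurfaceGCL.ale w δt '' SurfaceGCL.regularPart F, |φ x| ≤ M :=
      fun x hx => hM x (hsub hx)
    have ha : 0 ≤ (μHE[2] (SurfaceGCL.regularPart F)).toReal := ENNReal.toReal_nonneg
    constructor
    · refine (hP.abs_gap_le hφ hM0 hM' hL' (by linarith)).trans ?_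
      have : 0 ≤ M * (δt ^ 2 * |L| ^ 2) * (μHE[2] (SurfaceGCL.regularPart F)).toReal := by
        positivity
      linarith
    · refine (hP.abs_gap_inv_le hφ hM0 hM' hL' hδL).trans_eq ?_
      ring
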